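/- Let $\mathcal P$ be an LCL problem: a radius $r$, finite input and output alphabets, and a set of acceptable centred configurations; an output labeling is acceptable if the subgraph induced by the $r$-neighbourhood of each vertex, together with its vertex degrees, input labels, output labels and (if $\mathcal P$ refers to them) port numbers, is isomorphic to an acceptable configuration. Consider synchronous message passing with unbounded messages and free local computation, in which every vertex knows $n=|V|$, its degree, its input label and (in the version with port numbering) a port numbering of its incident edges; the input labels and the port numbering are arbitrary. In $\mathsf{DetLOCAL}$ the vertices also hold arbitrary distinct IDs from a range of size $n^k$, for a fixed integer $k\ge 1$. In $\mathsf{RandLOCAL}$ they hold independent private random bits instead, and the global failure probability must be at most $1/n$. The complexity of $\mathcal P$ on a graph class is the function of $n$ giving the least number of rounds that suffices on all $n$-vertex graphs of the class ($\infty$ if there is none). Then, both in $\mathsf{DetLOCAL}$ (for every $k\ge 1$) and in $\mathsf{RandLOCAL}$, with or without input labels and with or without port numbering: 1. on $n$-rings, if the complexity of $\mathcal P$ is $o(\log^* n)$, then it is $O(1)$; 2. on $\sqrt n\times\sqrt n$ tori, if the complexity of $\mathcal P$ is $o(\sqrt{\log^* n})$, then it is $O(1)$; 3. for every constant $\Delta$,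 on trees of maximum degree at most $\Delta$, and likewise on general graphs of maximum degree at most $\Delta$, if the complexity of $\mathcal P$ is $o(\log(\log^* n))$, then it is $O(1)$. In particular, no LCL problem has complexity in the range $\omega(1)$---$o(\log^* n)$ on $n$-rings, $\omega(1)$---$o(\sqrt{\log^* n})$ on $\sqrt n\times\sqrt n$ tori, or $\omega(1)$---$o(\log(\log^* n))$ on bounded-degree trees or bounded-degree general graphs. -/

import Mathlib

open MeasureTheory Filter

namespace LocalModel

/-! ### Communication networks -/

/-- A port numbering of `G`: every vertex `v` has a degree `deg v` and numbers its incident edges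
by `0, …, deg v - 1`; the edge with number `i` at `v` leads to the neighbour `nbr v i`.
The field `nbr` forces `deg v` to be the degree of `v` in `G`. -/
structure PortNumbering {V : Type} (G : SimpleGraph V) where
  deg : V → ℕ
  nbr : ∀ v, Fin (deg v) ≃ G.neighborSet v

/-- The number that `u` gives to its edge towards its neighbour `w`. -/
def PortNumbering.portTo {V : Type} {G : SimpleGraph V} (π : PortNumbering G)
    (u w : V) (h : G.Adj u w) : Fin (π.deg u) :=
  (π.nbr u).symm ⟨w, h⟩

/-- The set of vertices at distance at most `r` from `v`. -/
def nbhd {V : Type} (G : SimpleGraph V) (v : V) (r : ℕ) : Set V :=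
  {u | G.edist v u ≤ r}

theorem mem_nbhd_self {V : Type} (G : SimpleGraph V) (v : V) (r : ℕ) : v ∈ nbhd G v r := by
  simp [nbhd]

/-! ### Locally checkable labelings -/

/-- A finite graph with a centre in which each vertex has a degree, a port numbering, an input
label and an output label. The degree of a vertex is that in the surrounding network, of
which the graph is a fragment; `port u w` is the number at `u` of the edge from `u` to `w`
(its value is irrelevant if `u` and `w` are not adjacent). -/
structure Config (Inp Out : Type) where
  size : ℕ
  graph : SimpleGraph (Fin size)
  center : Fin size
  deg : Fin size → ℕ
  port : Fin size → Fin size → ℕ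
  inp : Fin size → Inp
  out : Fin size → Out

/-- An LCL problem with input alphabet `Inp` and output alphabet `Out`: a radius and a set of
acceptable configurations. -/
structure LCL (Inp Out : Type) where
  radius : ℕ
  configs : Set (Config Inp Out)

/-- The subgraph induced by the `r`-neighbourhood of `v`, together with the degrees, the input
labels, the output labels and, if `ports = true`, the port numbers stored there, is isomorphic
to `C` as a centred graph. -/
def Matches {Inp Out V : Type} (ports : Bool) (G : SimpleGraph V) (π : PortNumbering G)
    (inp : V → Inp) (out : V → Out) (v : V) (r : ℕ) (C : Config Inp Out) : Prop :=
  ∃ e : G.induce (nbhd G v r) ≃g C.graph,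
    e ⟨v, mem_nbhd_self G v r⟩ = C.center ∧
    (∀ u, C.deg (e u) = π.deg u ∧ C.inp (e u) = inp u ∧ C.out (e u) = out u) ∧
    (ports = true → ∀ (u w : nbhd G v r) (h : G.Adj u w),
      C.port (e u) (e w) = (π.portTo u w h : ℕ))

/-- `out` is an acceptable output for the LCL problem `P` on the network `G` with port
numbering `π` and input labels `inp`. With `ports = false`, `P` does not refer to the port
numbering. -/
def LCL.Valid {Inp Out V : Type} (P : LCL Inp Out) (ports : Bool) (G : SimpleGraph V)
    (π : PortNumbering G) (inp : V → Inp) (out : V → Out) : Prop :=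
  ∀ v, ∃ C ∈ P.configs, Matches ports G π inp out v P.radius C

/-! ### Synchronous message passing -/

/-- A synchronous distributed algorithm. Vertices initially know their degree, their input label
and a private value in `X` (an identifier, or a source of random bits). In every round a
vertex in state `s` sends the message `send s i` on its port `i`; a vertex of degree `d` in
state `s` that receives the messages `m 0, …, m (d-1)` on its ports moves to the state
`recv s d m`. States and messages are arbitrary: local computation is free and messages have
unbounded size. -/
structure Algorithm (Inp Out X : Type) where
  State : Type
  Msg : Type
  init : ℕ → Inp → X → State
  send : State → ℕ → Msg
  recv : State → (d : ℕ) → (Fin d → Msg) → State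
  out : State → Out

/-- The algorithm makes no use of port numbers: it sends the same message to all neighbours and
treats the incoming messages as a multiset. -/
def Algorithm.PortOblivious {Inp Out X : Type} (A : Algorithm Inp Out X) : Prop :=
  (∀ s i j, A.send s i = A.send s j) ∧
  ∀ s d (m : Fin d → A.Msg) (σ : Equiv.Perm (Fin d)), A.recv s d (m ∘ σ) = A.recv s d m

/-- The state of each vertex after `t` rounds. -/
def Algorithm.run {Inp Out X V : Type} (A : Algorithm Inp Out X) {G : SimpleGraph V}
    (π : PortNumbering G) (inp : V → Inp) (x : V → X) : ℕ → V → A.State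
  | 0, v => A.init (π.deg v) (inp v) (x v)
  | t + 1, v => A.recv (A.run π inp x t v) (π.deg v) fun i =>
      A.send (A.run π inp x t (π.nbr v i)) (π.portTo (π.nbr v i) v (π.nbr v i).2.symm)

/-- The output labels when all vertices stop after `t` rounds. -/
def Algorithm.output {Inp Out X V : Type} (A : Algorithm Inp Out X) {G : SimpleGraph V}
    (π : PortNumbering G) (inp : V → Inp) (x : V → X) (t : ℕ) (v : V) : Out :=
  A.out (A.run π inp x t v)

/-- A class of finite graphs; `n`-vertex graphs are taken on the vertex set `Fin n`. -/
abbrev GraphClass := ∀ n : ℕ, SimpleGraph (Fin n) → Prop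

/-! ### Complexity -/

/-- The problem `P` can be solved in `t` rounds in the deterministic model on the `n`-vertex
graphs of the class `𝒢`, when the vertices hold arbitrary distinct identifiers in
`{0, …, n ^ k - 1}`. The algorithm may depend on `n`, that is, `n` is known to all vertices. -/
def DetSolvable {Inp Out : Type} (𝒢 : GraphClass) (ports : Bool) (P : LCL Inp Out)
    (k n t : ℕ) : Prop :=
  ∃ A : Algorithm Inp Out ℕ, (ports = false → A.PortOblivious) ∧
    ∀ (G : SimpleGraph (Fin n)), 𝒢 n G → ∀ (π : PortNumbering G) (inp : Fin n → Inp)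
      (id : Fin n → ℕ), Function.Injective id → (∀ v, id v < n ^ k) →
      P.Valid ports G π inp (A.output π inp id t)

/-- The distribution of an infinite sequence of independent fair bits. -/
noncomputable def fairBits : Measure (ℕ → Bool) :=
  Measure.infinitePi fun _ => (PMF.uniformOfFintype Bool).toMeasure

instance : IsProbabilityMeasure fairBits := by
  unfold fairBits; infer_instance

/-- The problem `P` can be solved in `t` rounds in the randomized model on the `n`-vertex graphs
of the class `𝒢`: each vertex holds a private sequence of random bits, all of them independent,
and the global probability of failure is at most `1 / n`. -/
def RandSolvable {Inp Out : Type} (𝒢 : GraphClass) (ports : Bool) (P : LCL Inp Out)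
    (n t : ℕ) : Prop :=
  ∃ A : Algorithm Inp Out (ℕ → Bool), (ports = false → A.PortOblivious) ∧
    ∀ (G : SimpleGraph (Fin n)), 𝒢 n G → ∀ (π : PortNumbering G) (inp : Fin n → Inp),
      (∀ v o, MeasurableSet {ω : Fin n → ℕ → Bool | A.output π inp ω t v = o}) ∧
      Measure.pi (fun _ : Fin n => fairBits)
        {ω | ¬ P.Valid ports G π inp (A.output π inp ω t)} ≤ (n : ENNReal)⁻¹

/-- The deterministic complexity on `n`-vertex graphs (`⊤` if the problem is not solvable). -/
noncomputable def detComplexity {Inp Out : Type} (𝒢 : GraphClass) (ports : Bool)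
    (P : LCL Inp Out) (k n : ℕ) : ℕ∞ :=
  ⨅ t ∈ {t : ℕ | DetSolvable 𝒢 ports P k n t}, (t : ℕ∞)

/-- The randomized complexity on `n`-vertex graphs (`⊤` if the problem is not solvable). -/
noncomputable def randComplexity {Inp Out : Type} (𝒢 : GraphClass) (ports : Bool)
    (P : LCL Inp Out) (n : ℕ) : ℕ∞ :=
  ⨅ t ∈ {t : ℕ | RandSolvable 𝒢 ports P n t}, (t : ℕ∞)

/-- `c = o(f)`. -/
def LittleO (c : ℕ → ℕ∞) (f : ℕ → ℝ) : Prop :=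
  ∀ ε : ℝ, 0 < ε → ∀ᶠ n in atTop, ∃ t : ℕ, c n ≤ t ∧ (t : ℝ) ≤ ε * f n

/-- `c = O(1)`. -/
def BigOOne (c : ℕ → ℕ∞) : Prop :=
  ∃ C : ℕ, ∀ᶠ n in atTop, c n ≤ C

/-- On the class `𝒢`, the complexity of `P` does not lie in the gap between `O(1)` and `f`: in the
deterministic model, for identifiers from any polynomial range, and in the randomized model,
a complexity `o(f)` is in fact `O(1)`. -/
def GapBelow {Inp Out : Type} (𝒢 : GraphClass) (ports : Bool) (P : LCL Inp Out)
    (f : ℕ → ℝ) : Prop :=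
  (∀ k : ℕ, 1 ≤ k → LittleO (detComplexity 𝒢 ports P k) f →
    BigOOne (detComplexity 𝒢 ports P k)) ∧
  (LittleO (randComplexity 𝒢 ports P) f → BigOOne (randComplexity 𝒢 ports P))

/-! ### Graph classes and the iterated logarithm -/

/-- The `n`-ring. -/
def ring : GraphClass := fun n G => 3 ≤ n ∧ Nonempty (G ≃g SimpleGraph.cycleGraph n)

/-- The `√n × √n` torus. -/
def torus : GraphClass := fun n G => ∃ s : ℕ, 3 ≤ s ∧ n = s * s ∧
  Nonempty (G ≃g (SimpleGraph.cycleGraph s).boxProd (SimpleGraph.cycleGraph s))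

/-- All graphs of maximum degree at most `Δ`. -/
def boundedDegree (Δ : ℕ) : GraphClass := fun _ G => ∀ v, (G.neighborSet v).ncard ≤ Δ

/-- All trees of maximum degree at most `Δ`. -/
def boundedDegreeTree (Δ : ℕ) : GraphClass := fun n G => G.IsTree ∧ boundedDegree Δ n G

/-- `log* n`: how often `log₂` has to be applied, starting from `n`, to reach a value `≤ 1`. -/
noncomputable def logStar (n : ℕ) : ℕ :=
  sInf {i : ℕ | (Real.logb 2)^[i] (n : ℝ) ≤ 1}

end LocalModel

/-!
A fast algorithm is turned into one whose number of rounds is constant by reusing it at one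
fixed network size `m`.

Whether the outputs after `T` rounds are acceptable at a vertex is determined by its `LocalView`
of radius `R = r + T + 1`, where `r` is the radius of the problem. This is a finite object with at
most `p` vertices, where, up to an additive constant in `R`, the number `p` is `2 R + 1` for
rings, `(2 R + 1) ^ 2` for tori and `(Δ + 1) ^ R` for bounded degree. Every neighbourhood in a
large graph of the class also occurs in an `m`-vertex graph of the class (`Embeds`): all rings,
and likewise all tori, are quotients of one infinite graph, and in a tree or a general graph one
takes the subgraph induced by `m` vertices around the given one. Hence an algorithm for `m`-vertex
graphs is correct at every vertex of a larger graph as soon as the identifiers within distance `R`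
are distinct and lie in the range for which the algorithm is made (`LocallySolves`,
`locallySolves_of_det`). For a randomized algorithm, the random bits are first fixed as a function
of identifiers from a range of size `M`; a union bound over all local views with such identifiers
shows that this is possible if their number is less than `m` (`exists_locallySolves_of_rand`).

Identifiers of larger networks do not fit into this range, but Ramsey's theorem provides a set of
`2 p` identifiers on which the output depends only on the relative order. Replacing the
identifiers seen by a vertex by elements of this set, according to their ranks, yields an
algorithm that works for all identifiers (`Algorithm.orderInvariant`,
`exists_valid_of_locallySolves`). In the randomized model, identifiers are drawn at random and are
distinct with high probability (`randSolvable_of_forall_valid`).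

The Erdős–Rado proof of Ramsey's theorem needs a range whose size is a tower of height `O(p)`
(`ramseyBound_le_tower`), so all requirements on `m` are met if `K * p + K ≤ log* m` for a
constant `K` (`exists_forall_ramseyBound_le`). This holds for some large `m` if `T` is `o(log*)`,
`o(√log*)` or `o(log log*)`, respectively; the corresponding `T` is then a bound on the
complexity for all sufficiently large networks (`gapBelow_of_embeds`).
-/

open MeasureTheory Filter

namespace LocalModel

/-! ### Neighbourhoods -/

section Nbhd

variable {V : Type} {G : SimpleGraph V} {u v w : V} {i j r s : ℕ}

theorem mem_nbhd_iff_exists_walk : u ∈ nbhd G v r ↔ ∃ p : G.Walk v u, p.length ≤ r := by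
  constructor
  · intro h
    have h' : G.edist v u ≤ r := h
    obtain ⟨p, hp⟩ := SimpleGraph.exists_walk_of_edist_ne_top
      (ne_top_of_le_ne_top (ENat.natCast_ne_top r) h')
    refine ⟨p, ?_⟩
    rw [← hp] at h'
    exact_mod_cast h'
  · rintro ⟨p, hp⟩
    exact (SimpleGraph.edist_le p).trans (by exact_mod_cast hp)

theorem mem_nbhd_zero : u ∈ nbhd G v 0 ↔ u = v := by
  simp [nbhd, eq_comm (a := v)]

theorem nbhd_mono (h : r ≤ s) : nbhd G v r ⊆ nbhd G v s := fun _ hu =>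
  le_trans (b := (r : ℕ∞)) hu (by exact_mod_cast h)

theorem mem_nbhd_trans (h : u ∈ nbhd G v i) (h' : w ∈ nbhd G u j) : w ∈ nbhd G v (i + j) := by
  have h1 : G.edist v u ≤ i := h
  have h2 : G.edist u w ≤ j := h'
  exact SimpleGraph.edist_triangle.trans (by push_cast; exact add_le_add h1 h2)

theorem mem_nbhd_of_adj (h : u ∈ nbhd G v i) (h' : G.Adj u w) : w ∈ nbhd G v (i + 1) :=
  mem_nbhd_trans h (mem_nbhd_iff_exists_walk.2 ⟨h'.toWalk, by simp⟩)

theorem mem_nbhd_succ : u ∈ nbhd G v (j + 1) ↔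
    u ∈ nbhd G v j ∨ ∃ w ∈ nbhd G v j, G.Adj w u := by
  constructor
  · intro h
    obtain ⟨p, hp⟩ := mem_nbhd_iff_exists_walk.1 h
    by_cases hu : p.length ≤ j
    · exact .inl (mem_nbhd_iff_exists_walk.2 ⟨p, hu⟩)
    · refine .inr ⟨p.penultimate, mem_nbhd_iff_exists_walk.2 ⟨p.dropLast, ?_⟩, ?_⟩
      · simp; omega
      · apply p.adj_penultimate
        intro hn
        have := SimpleGraph.Walk.length_eq_zero_iff.2 hn
        omega
  · rintro (h | ⟨w, hw, hadj⟩)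
    · exact nbhd_mono (Nat.le_succ j) h
    · exact mem_nbhd_of_adj hw hadj

end Nbhd

/-! ### Local views -/

/-- A local view on the vertex set `W`: for every vertex its degree, which is at most `Δ`, its
input label, the endpoints of its incident edges in the order of their port numbers, and the
port numbers that these edges have at the other endpoint. No consistency is required, so that
the fragment of a network around a vertex can be recorded without a boundary condition; the
entries of `nbr` and `port` beyond the degree are irrelevant. -/
@[ext]
structure LocalView (Δ : ℕ) (Inp W : Type) where
  deg : W → Fin (Δ + 1)
  inp : W → Inp
  nbr : W → Fin Δ → W
  port : W → Fin Δ → Fin Δ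

/-- The `i`-th port of a vertex of a local view, as one of `Δ` possible ports. -/
def LocalView.slot {Δ : ℕ} {Inp W : Type} (N : LocalView Δ Inp W) (a : W)
    (i : Fin (N.deg a : ℕ)) : Fin Δ :=
  ⟨i, lt_of_lt_of_le i.2 (Nat.lt_succ_iff.1 (N.deg a).2)⟩

/-- The state of each vertex of a local view after `t` rounds. -/
def LocalView.run {Δ : ℕ} {Inp W X : Type} {Out : Type} (N : LocalView Δ Inp W)
    (A : Algorithm Inp Out X) (x : W → X) : ℕ → W → A.State
  | 0, a => A.init (N.deg a) (N.inp a) (x a)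
  | t + 1, a => A.recv (N.run A x t a) (N.deg a) fun i =>
      A.send (N.run A x t (N.nbr a (N.slot a i))) (N.port a (N.slot a i))

/-- The map `e` identifies the vertices at distance at most `R` from `v` with vertices of the
local view `N`, which records the network faithfully there. At distance `R + 1` the map `e` is
only required to be compatible with `nbr`. -/
structure IsView {Δ : ℕ} {Inp V W : Type} (N : LocalView Δ Inp W) (e : V → W)
    (G : SimpleGraph V) (π : PortNumbering G) (inp : V → Inp) (v : V) (R : ℕ) : Prop where
  inj : Set.InjOn e (nbhd G v R)
  deg : ∀ u ∈ nbhd G v R, (N.deg (e u) : ℕ) = π.deg u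
  inp : ∀ u ∈ nbhd G v R, N.inp (e u) = inp u
  nbr : ∀ u ∈ nbhd G v R, ∀ (i : Fin (π.deg u)) (j : Fin Δ), (i : ℕ) = j →
    N.nbr (e u) j = e (π.nbr u i)
  port : ∀ u ∈ nbhd G v R, ∀ (i : Fin (π.deg u)) (j : Fin Δ), (i : ℕ) = j →
    (π.nbr u i : V) ∈ nbhd G v R →
    (N.port (e u) j : ℕ) = π.portTo (π.nbr u i) u (π.nbr u i).2.symm

theorem Algorithm.recv_congr {Inp Out X : Type} (A : Algorithm Inp Out X) {s s' : A.State}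
    {d d' : ℕ} {m : Fin d → A.Msg} {m' : Fin d' → A.Msg} (hs : s = s') (hd : d = d')
    (hm : ∀ i (hi : i < d) (hi' : i < d'), m ⟨i, hi⟩ = m' ⟨i, hi'⟩) :
    A.recv s d m = A.recv s' d' m' := by
  subst hs hd
  congr 1
  funext i
  exact hm i i.2 i.2

section View

variable {Δ : ℕ} {Inp Out V V' W X : Type} {N : LocalView Δ Inp W} {e : V → W}
  {G : SimpleGraph V} {π : PortNumbering G} {inp : V → Inp} {v : V} {R : ℕ}
  {e' : V' → W} {G' : SimpleGraph V'} {π' : PortNumbering G'} {inp' : V' → Inp} {v' : V'}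

theorem IsView.mono (h : IsView N e G π inp v R) {u : V} {R' i : ℕ} (hu : u ∈ nbhd G v i)
    (hR : i + R' ≤ R) : IsView N e G π inp u R' := by
  have hs : nbhd G u R' ⊆ nbhd G v R := fun w hw => nbhd_mono hR (mem_nbhd_trans hu hw)
  exact ⟨h.inj.mono hs, fun w hw => h.deg w (hs hw), fun w hw => h.inp w (hs hw),
    fun w hw => h.nbr w (hs hw), fun w hw i j hij hw' => h.port w (hs hw) i j hij (hs hw')⟩

theorem IsView.lt (h : IsView N e G π inp v R) {u : V} (hu : u ∈ nbhd G v R)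
    (i : Fin (π.deg u)) : (i : ℕ) < Δ := by
  have h1 := h.deg u hu
  have h2 := (N.deg (e u)).2
  have := i.2
  omega

/-- A computation of `t` rounds at `u` can be followed in a local view of radius `t`. -/
theorem IsView.run_eq (h : IsView N e G π inp v R) (A : Algorithm Inp Out X) {x : V → X}
    {y : W → X} (hxy : ∀ u ∈ nbhd G v R, x u = y (e u)) :
    ∀ (t s : ℕ) (u : V), u ∈ nbhd G v s → s + t ≤ R →
      A.run π inp x t u = N.run A y t (e u)
  | 0, s, u, hu, hR => by
    have hu' := nbhd_mono (by omega : s ≤ R) hu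
    simp only [Algorithm.run, LocalView.run]
    rw [h.deg u hu', h.inp u hu', hxy u hu']
  | t + 1, s, u, hu, hR => by
    have hu' := nbhd_mono (by omega : s ≤ R) hu
    simp only [Algorithm.run, LocalView.run]
    refine A.recv_congr (h.run_eq A hxy t s u hu (by omega)) (h.deg u hu').symm ?_
    intro i hi hi'
    have hn : (π.nbr u ⟨i, hi⟩ : V) ∈ nbhd G v (s + 1) := mem_nbhd_of_adj hu (π.nbr u ⟨i, hi⟩).2
    rw [h.run_eq A hxy t (s + 1) _ hn (by omega),
      h.nbr u hu' ⟨i, hi⟩ (N.slot (e u) ⟨i, hi'⟩) rfl,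
      h.port u hu' ⟨i, hi⟩ (N.slot (e u) ⟨i, hi'⟩) rfl (nbhd_mono (by omega) hn)]

theorem IsView.exists_mem_nbhd (h : IsView N e G π inp v R) (h' : IsView N e' G' π' inp' v' R)
    (hv : e v = e' v') : ∀ j ≤ R, ∀ u ∈ nbhd G v j, ∃ u' ∈ nbhd G' v' j, e' u' = e u
  | 0, _, u, hu => ⟨v', mem_nbhd_self _ _ _, by rw [mem_nbhd_zero.1 hu, hv]⟩
  | j + 1, hj, u, hu => by
    rcases mem_nbhd_succ.1 hu with hu | ⟨w, hw, hadj⟩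
    · obtain ⟨u', hu', he⟩ := h.exists_mem_nbhd h' hv j (by omega) u hu
      exact ⟨u', nbhd_mono (by omega) hu', he⟩
    · obtain ⟨w', hw', he⟩ := h.exists_mem_nbhd h' hv j (by omega) w hw
      have hwR := nbhd_mono (by omega : j ≤ R) hw
      have hwR' := nbhd_mono (by omega : j ≤ R) hw'
      obtain ⟨i, hi⟩ := (π.nbr w).surjective ⟨u, hadj⟩
      have hd : π.deg w = π'.deg w' := by rw [← h.deg w hwR, ← h'.deg w' hwR', he]
      refine ⟨π'.nbr w' ⟨i, hd ▸ i.2⟩, mem_nbhd_of_adj hw' (π'.nbr w' _).2, ?_⟩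
      rw [← h'.nbr w' hwR' _ ⟨i, h.lt hwR i⟩ rfl, he, h.nbr w hwR i ⟨i, h.lt hwR i⟩ rfl, hi]

/-- Two vertices in the interior of a local view determine whether they are adjacent, and by which
port. -/
theorem IsView.portTo_eq (h : IsView N e G π inp v (R + 1))
    (h' : IsView N e' G' π' inp' v' (R + 1)) {a b : V} {a' b' : V'} (ha : a ∈ nbhd G v R)
    (ha' : a' ∈ nbhd G' v' R) (hb' : b' ∈ nbhd G' v' R)
    (hea : e' a' = e a) (heb : e' b' = e b) (hab : G.Adj a b) :
    ∃ hab' : G'.Adj a' b', (π'.portTo a' b' hab' : ℕ) = π.portTo a b hab := by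
  have haR := nbhd_mono (by omega : R ≤ R + 1) ha
  have haR' := nbhd_mono (by omega : R ≤ R + 1) ha'
  have hbR' := nbhd_mono (by omega : R ≤ R + 1) hb'
  set i := π.portTo a b hab with hi
  have hib : (π.nbr a i : V) = b := by simp [hi, PortNumbering.portTo]
  have hd : π.deg a = π'.deg a' := by rw [← h.deg a haR, ← h'.deg a' haR', hea]
  have hin : (⟨i, hd ▸ i.2⟩ : Fin (π'.deg a')).val = i := rfl
  set i' : Fin (π'.deg a') := ⟨i, hd ▸ i.2⟩
  have hn : (π'.nbr a' i' : V') = b' := by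
    refine h'.inj (mem_nbhd_of_adj ha' (π'.nbr a' i').2) hbR' ?_
    rw [← h'.nbr a' haR' i' ⟨i, h.lt haR i⟩ rfl, hea, h.nbr a haR i ⟨i, h.lt haR i⟩ rfl, hib, heb]
  refine ⟨hn ▸ (π'.nbr a' i').2, ?_⟩
  rw [← hin]
  congr 1
  rw [PortNumbering.portTo, Equiv.symm_apply_eq]
  exact Subtype.ext hn.symm

/-- Whether a configuration matches at the centre depends on the local view only. The radius of the
view exceeds that of the configuration by one, so that the endpoints of all edges at vertices of
the configuration can be told apart. -/
theorem IsView.matches_transfer (h : IsView N e G π inp v (R + 1))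
    (h' : IsView N e' G' π' inp' v' (R + 1)) (hv : e v = e' v') {out : V → Out}
    {out' : V' → Out}
    (hout : ∀ u ∈ nbhd G v R, ∀ u' ∈ nbhd G' v' R, e u = e' u' → out u = out' u')
    {ports : Bool} {C : Config Inp Out} (hC : Matches ports G' π' inp' out' v' R C) :
    Matches ports G π inp out v R C := by
  obtain ⟨f, hf, hlab, hport⟩ := hC
  have hR := fun u => nbhd_mono (G := G) (v := v) (by omega : R ≤ R + 1) (a := u)
  have hR' := fun u => nbhd_mono (G := G') (v := v') (by omega : R ≤ R + 1) (a := u)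
  choose θ hθ heθ using h.exists_mem_nbhd h' hv R (by omega)
  choose η hη heη using h'.exists_mem_nbhd h hv.symm R (by omega)
  have hadj : ∀ a ha b hb, G'.Adj (θ a ha) (θ b hb) ↔ G.Adj a b := by
    intro a ha b hb
    constructor
    · intro hab
      exact (h'.portTo_eq h (hθ a ha) ha hb (heθ a ha).symm (heθ b hb).symm hab).1
    · intro hab
      exact (h.portTo_eq h' ha (hθ a ha) (hθ b hb) (heθ a ha) (heθ b hb) hab).1
  let Θ : G.induce (nbhd G v R) ≃g G'.induce (nbhd G' v' R) :=
    { toFun := fun u => ⟨θ u u.2, hθ u u.2⟩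
      invFun := fun u => ⟨η u u.2, hη u u.2⟩
      left_inv := fun u => Subtype.ext <| h.inj (hR _ (hη _ _)) (hR _ u.2) <| by
        rw [heη, heθ]
      right_inv := fun u => Subtype.ext <| h'.inj (hR' _ (hθ _ _)) (hR' _ u.2) <| by
        rw [heθ, heη]
      map_rel_iff' := fun {a b} => hadj a a.2 b b.2 }
  refine ⟨Θ.trans f, ?_, ?_, ?_⟩
  · rw [← hf]
    change f _ = f _
    congr 1
    apply Subtype.ext
    exact h'.inj (hR' _ (hθ _ _)) (mem_nbhd_self _ _ _) (by rw [heθ, hv])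
  · intro u
    obtain ⟨h1, h2, h3⟩ := hlab (Θ u)
    have he : e' (Θ u) = e u := heθ u u.2
    refine ⟨h1.trans ?_, h2.trans ?_, h3.trans ?_⟩
    · rw [← h'.deg _ (hR' _ (Θ u).2), he, h.deg _ (hR _ u.2)]
    · rw [← h'.inp _ (hR' _ (Θ u).2), he, h.inp _ (hR _ u.2)]
    · exact (hout u u.2 (Θ u) (Θ u).2 he.symm).symm
  · intro hp u w huw
    obtain ⟨h1, h2⟩ := h.portTo_eq h' u.2 (Θ u).2 (Θ w).2 (heθ u u.2) (heθ w w.2) huw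
    exact (hport hp (Θ u) (Θ w) h1).trans h2

end View

section Views

variable {Δ : ℕ} {Inp V W : Type} {G : SimpleGraph V} {π : PortNumbering G} {v : V} {R : ℕ}
  {e : V → W}

theorem PortNumbering.deg_eq_ncard (π : PortNumbering G) (u : V) :
    π.deg u = (G.neighborSet u).ncard := by
  rw [← Nat.card_coe_set_eq, ← Nat.card_congr (π.nbr u), Nat.card_fin]

theorem PortNumbering.nbr_portTo (π : PortNumbering G) {u w : V} (h : G.Adj u w) :
    (π.nbr u (π.portTo u w h) : V) = w := by
  simp [PortNumbering.portTo]

theorem exists_isView (hΔ : ∀ u, π.deg u ≤ Δ) (inp : V → Inp)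
    (he : Set.InjOn e (nbhd G v R)) : ∃ N : LocalView Δ Inp W, IsView N e G π inp v R := by
  classical
  have : Nonempty V := ⟨v⟩
  let g : W → V := Function.invFunOn e (nbhd G v R)
  have hg : ∀ u ∈ nbhd G v R, g (e u) = u := fun u hu => he.leftInvOn_invFunOn hu
  refine ⟨⟨fun a => ⟨π.deg (g a), Nat.lt_succ_iff.2 (hΔ _)⟩, fun a => inp (g a),
    fun a i => if hi : (i : ℕ) < π.deg (g a) then e (π.nbr (g a) ⟨i, hi⟩) else a,
    fun a i => if hi : (i : ℕ) < π.deg (g a) then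
      ⟨π.portTo (π.nbr (g a) ⟨i, hi⟩) (g a) (π.nbr (g a) ⟨i, hi⟩).2.symm,
        lt_of_lt_of_le (Fin.is_lt _) (hΔ _)⟩ else i⟩, he, ?_, ?_, ?_, ?_⟩
  · intro u hu
    simp [hg u hu]
  · intro u hu
    simp [hg u hu]
  · rintro u hu ⟨i, hi⟩ ⟨j, hj⟩ rfl
    have hgu := hg u hu
    dsimp only
    generalize g (e u) = u' at hgu
    subst hgu
    rw [dif_pos hi]
  · rintro u hu ⟨i, hi⟩ ⟨j, hj⟩ rfl _
    have hgu := hg u hu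
    dsimp only
    generalize g (e u) = u' at hgu
    subst hgu
    rw [dif_pos hi]

/-- If `ψ` maps the neighbourhood of `v` in one network isomorphically onto that of `ψ v` in
a graph `G'`, then ports and input labels can be chosen on `G'` so that both vertices
have the same local view. -/
theorem IsView.exists_map {N : LocalView Δ Inp W} {inp : V → Inp}
    (h : IsView N e G π inp v R) {V' : Type} [Finite V'] (G' : SimpleGraph V') (ψ : V → V')
    (hψ : Set.InjOn ψ (nbhd G v (R + 1)))
    (hn : ∀ u ∈ nbhd G v R, ψ '' G.neighborSet u = G'.neighborSet (ψ u)) :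
    ∃ (π' : PortNumbering G') (inp' : V' → Inp) (e' : V' → W),
      IsView N e' G' π' inp' (ψ v) R ∧ e' (ψ v) = e v := by
  classical
  have : Nonempty V := ⟨v⟩
  have hsub : nbhd G v R ⊆ nbhd G v (R + 1) := nbhd_mono (Nat.le_succ R)
  have hports : ∀ a : V', ∃ (d : ℕ) (f : Fin d ≃ G'.neighborSet a), ∀ u ∈ nbhd G v R, ψ u = a →
      ∃ hd : d = π.deg u, ∀ i : Fin d, (f i : V') = ψ (π.nbr u (Fin.cast hd i)) := by
    intro a
    by_cases ha : ∃ u ∈ nbhd G v R, ψ u = a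
    · obtain ⟨u, hu, rfl⟩ := ha
      have hb : Set.BijOn ψ (G.neighborSet u) (G'.neighborSet (ψ u)) := by
        rw [← hn u hu]
        exact (hψ.mono fun w hw => mem_nbhd_of_adj hu hw).bijOn_image
      refine ⟨π.deg u, (π.nbr u).trans hb.equiv, ?_⟩
      intro w hw hwu
      obtain rfl : w = u := hψ (hsub hw) (hsub hu) hwu
      exact ⟨rfl, fun i => rfl⟩
    · refine ⟨Nat.card (G'.neighborSet a), (Finite.equivFin _).symm, ?_⟩
      intro u hu hua
      exact absurd ⟨u, hu, hua⟩ ha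
  choose d f hf using hports
  let π' : PortNumbering G' := ⟨d, f⟩
  let g : V' → V := Function.invFunOn ψ (nbhd G v (R + 1))
  have hg : ∀ u ∈ nbhd G v (R + 1), g (ψ u) = u := fun u hu => hψ.leftInvOn_invFunOn hu
  have hnb : ∀ j ≤ R + 1, ∀ a ∈ nbhd G' (ψ v) j, ∃ u ∈ nbhd G v j, ψ u = a := by
    intro j
    induction j with
    | zero =>
      intro _ a ha
      exact ⟨v, mem_nbhd_self _ _ _, (mem_nbhd_zero.1 ha).symm⟩
    | succ j ih =>
      intro hj a ha
      rcases mem_nbhd_succ.1 ha with ha | ⟨b, hb, hba⟩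
      · obtain ⟨u, hu, rfl⟩ := ih (by omega) a ha
        exact ⟨u, nbhd_mono (Nat.le_succ j) hu, rfl⟩
      · obtain ⟨u, hu, rfl⟩ := ih (by omega) b hb
        have hba' : a ∈ G'.neighborSet (ψ u) := hba
        rw [← hn u (nbhd_mono (by omega) hu)] at hba'
        obtain ⟨w, hw, rfl⟩ := hba'
        exact ⟨w, mem_nbhd_of_adj hu hw, rfl⟩
  have hdeg : ∀ u ∈ nbhd G v R, π'.deg (ψ u) = π.deg u := fun u hu => (hf _ u hu rfl).1
  have hnbr : ∀ u ∈ nbhd G v R, ∀ (i : Fin (π'.deg (ψ u))) (j : Fin (π.deg u)), (i : ℕ) = j →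
      (π'.nbr (ψ u) i : V') = ψ (π.nbr u j) := by
    intro u hu i j hij
    obtain ⟨h1, h2⟩ := hf _ u hu rfl
    refine (h2 i).trans ?_
    congr 3
    exact Fin.ext hij
  have hport : ∀ u ∈ nbhd G v R, ∀ w ∈ nbhd G v R, ∀ a, a = ψ w → ∀ (huw : G.Adj w u)
      (huw' : G'.Adj a (ψ u)), (π'.portTo a (ψ u) huw' : ℕ) = π.portTo w u huw := by
    rintro u hu w hw _ rfl huw huw'
    have hin : (⟨π.portTo w u huw, (hdeg w hw).symm ▸ Fin.is_lt _⟩ : Fin (π'.deg (ψ w))).val =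
      π.portTo w u huw := rfl
    rw [← hin]
    congr 1
    rw [PortNumbering.portTo, Equiv.symm_apply_eq]
    apply Subtype.ext
    rw [hnbr w hw _ (π.portTo w u huw) rfl, PortNumbering.nbr_portTo]
  have hmem : ∀ a ∈ nbhd G' (ψ v) R, ∃ u ∈ nbhd G v R, ψ u = a := hnb R (by omega)
  refine ⟨π', fun a => inp (g a), fun a => e (g a), ⟨?_, ?_, ?_, ?_, ?_⟩, ?_⟩
  · intro a ha b hb hab
    obtain ⟨u, hu, rfl⟩ := hmem a ha
    obtain ⟨w, hw, rfl⟩ := hmem b hb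
    simp only [hg u (hsub hu), hg w (hsub hw)] at hab
    rw [h.inj hu hw hab]
  · intro a ha
    obtain ⟨u, hu, rfl⟩ := hmem a ha
    rw [hg u (hsub hu), hdeg u hu, h.deg u hu]
  · intro a ha
    obtain ⟨u, hu, rfl⟩ := hmem a ha
    rw [hg u (hsub hu), h.inp u hu]
  · intro a ha i j hij
    obtain ⟨u, hu, rfl⟩ := hmem a ha
    have hi : (i : ℕ) < π.deg u := hdeg u hu ▸ i.2
    rw [hnbr u hu i ⟨i, hi⟩ rfl, hg u (hsub hu), hg _ (mem_nbhd_of_adj hu (π.nbr u ⟨i, hi⟩).2),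
      h.nbr u hu ⟨i, hi⟩ j hij]
  · intro a ha i j hij hw
    obtain ⟨u, hu, rfl⟩ := hmem a ha
    have hi : (i : ℕ) < π.deg u := hdeg u hu ▸ i.2
    have hwn := mem_nbhd_of_adj hu (π.nbr u ⟨i, hi⟩).2
    have hnn := hnbr u hu i ⟨i, hi⟩ rfl
    have hwR : (π.nbr u ⟨i, hi⟩ : V) ∈ nbhd G v R := by
      obtain ⟨w, hw1, hw2⟩ := hmem _ hw
      rw [hnn] at hw2
      rwa [← hψ (hsub hw1) hwn hw2]
    rw [hg u (hsub hu), h.port u hu ⟨i, hi⟩ j hij hwR]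
    exact (hport u hu _ hwR _ hnn _ _).symm
  · exact congrArg e (hg v (mem_nbhd_self _ _ _))

end Views

/-! ### Ramsey's theorem with a tower-type bound -/

/-- A number of points that suffices for a homogeneous `m`-subset with respect to colourings of
`p`-subsets with `c` colours. -/
def ramseyBound (c m : ℕ) : ℕ → ℕ
  | 0 => m
  | p + 1 => (c ^ 2 ^ (ramseyBound c m p + 1) + 1) ^ (ramseyBound c m p + 2)

/-- The points of `E` are chosen one after the other, always the least of the remaining ones; the
remaining points are then thinned out so that the colour of a set formed by chosen points and
one remaining point `y` does not depend on `y`. The points chosen so far are those of `F`. -/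
theorem exists_endHomogeneous_aux {C : Type} [Finite C] (χ : Finset ℕ → C) (L : ℕ) :
    ∀ (j : ℕ) (F Y : Finset ℕ), F.card + j ≤ L → (∀ a ∈ F, ∀ y ∈ Y, a < y) →
      (∀ A ⊆ F, ∀ y ∈ Y, ∀ y' ∈ Y, χ (insert y A) = χ (insert y' A)) →
      (Nat.card C ^ 2 ^ L + 1) ^ j ≤ Y.card →
      ∃ E ⊆ Y, E.card = j ∧ ∀ A ⊆ F ∪ E, ∀ y ∈ E, ∀ y' ∈ E, (∀ a ∈ A, a < y) →
        (∀ a ∈ A, a < y') → χ (insert y A) = χ (insert y' A)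
  | 0, F, Y, _, _, _, _ => ⟨∅, by simp, by simp, by simp⟩
  | j + 1, F, Y, hL, hFY, hχ, hY => by
    classical
    have := Fintype.ofFinite C
    have hne : Y.Nonempty := Finset.card_pos.1 (lt_of_lt_of_le (by positivity) hY)
    set a := Y.min' hne with ha
    have haY : a ∈ Y := Y.min'_mem hne
    have haF : a ∉ F := fun h => lt_irrefl _ (hFY a h a haY)
    let F' := insert a F
    have hF' : F'.card = F.card + 1 := Finset.card_insert_of_notMem haF
    let f : ℕ → (F'.powerset → C) := fun y A => χ (insert y A)
    have hcard : Fintype.card (F'.powerset → C) ≤ Nat.card C ^ 2 ^ L := by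
      have hC : 0 < Nat.card C := Nat.card_pos_iff.2 ⟨⟨χ ∅⟩, inferInstance⟩
      rw [Fintype.card_fun, Fintype.card_coe, Finset.card_powerset, Nat.card_eq_fintype_card]
      rw [Nat.card_eq_fintype_card] at hC
      exact Nat.pow_le_pow_right hC (Nat.pow_le_pow_right two_pos (by omega))
    have hpig : ∃ k ∈ (Finset.univ : Finset (F'.powerset → C)),
        (Nat.card C ^ 2 ^ L + 1) ^ j ≤ ((Y.erase a).filter fun y => f y = k).card := by
      refine Finset.exists_le_card_fiber_of_mul_le_card_of_maps_to (fun _ _ => Finset.mem_univ _)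
        ⟨f 0, Finset.mem_univ _⟩ ?_
      rw [Finset.card_univ, Finset.card_erase_of_mem haY]
      refine (Nat.mul_le_mul_right _ hcard).trans ?_
      have h1 : (Nat.card C ^ 2 ^ L + 1) ^ (j + 1) = Nat.card C ^ 2 ^ L *
        (Nat.card C ^ 2 ^ L + 1) ^ j + (Nat.card C ^ 2 ^ L + 1) ^ j := by ring
      have h2 : 0 < (Nat.card C ^ 2 ^ L + 1) ^ j := by positivity
      omega
    obtain ⟨k, -, hk⟩ := hpig
    set Y' := (Y.erase a).filter fun y => f y = k with hY'
    have hY'Y : ∀ y ∈ Y', y ∈ Y ∧ a < y := by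
      intro y hy
      have hy' := Finset.mem_erase.1 (Finset.mem_filter.1 hy).1
      exact ⟨hy'.2, lt_of_le_of_ne (Y.min'_le y hy'.2) (Ne.symm hy'.1)⟩
    obtain ⟨E, hEY, hEc, hE⟩ := exists_endHomogeneous_aux χ L j F' Y' (by omega) (by
        intro b hb y hy
        rcases Finset.mem_insert.1 hb with rfl | hb
        · exact (hY'Y y hy).2
        · exact hFY b hb y (hY'Y y hy).1) (by
        intro A hA y hy y' hy'
        have h1 : f y = f y' :=
          (Finset.mem_filter.1 hy).2.trans (Finset.mem_filter.1 hy').2.symm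
        exact congrFun h1 ⟨A, Finset.mem_powerset.2 hA⟩) hk
    have haE : a ∉ E := fun h => lt_irrefl _ (hY'Y a (hEY h)).2
    have hYE : ∀ y ∈ insert a E, y ∈ Y ∧ a ≤ y := by
      intro y hy
      rcases Finset.mem_insert.1 hy with rfl | hy
      · exact ⟨haY, le_rfl⟩
      · exact ⟨(hY'Y y (hEY hy)).1, (hY'Y y (hEY hy)).2.le⟩
    have hAF : ∀ A ⊆ F ∪ insert a E, (∀ b ∈ A, b < a) → A ⊆ F := by
      intro A hA hAa b hb
      rcases Finset.mem_union.1 (hA hb) with h | h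
      · exact h
      · exact absurd (hYE b h).2 (not_le.2 (hAa b hb))
    refine ⟨insert a E, fun y hy => (hYE y hy).1, by rw [Finset.card_insert_of_notMem haE, hEc],
      ?_⟩
    intro A hA y hy y' hy' hAy hAy'
    by_cases h : y ∈ E ∧ y' ∈ E
    · refine hE A ?_ y h.1 y' h.2 hAy hAy'
      rw [Finset.insert_union, ← Finset.union_insert]
      exact hA
    · have hAa : A ⊆ F := by
        rcases not_and_or.1 h with h | h
        · obtain rfl := (Finset.mem_insert.1 hy).resolve_right h
          exact hAF A hA hAy
        · obtain rfl := (Finset.mem_insert.1 hy').resolve_right h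
          exact hAF A hA hAy'
      exact hχ A hAa y (hYE y hy).1 y' (hYE y' hy').1

/-- A large set has an end-homogeneous subset of a given size: one in which the colour of a set
does not depend on its largest element. -/
theorem exists_endHomogeneous {C : Type} [Finite C] (χ : Finset ℕ → C) (L : ℕ) (Y : Finset ℕ)
    (hY : (Nat.card C ^ 2 ^ L + 1) ^ (L + 1) ≤ Y.card) :
    ∃ E ⊆ Y, E.card = L ∧ ∀ A ⊆ E, ∀ y ∈ E, ∀ y' ∈ E, (∀ a ∈ A, a < y) →
      (∀ a ∈ A, a < y') → χ (insert y A) = χ (insert y' A) := by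
  classical
  have := Fintype.ofFinite C
  -- Colours of singletons are made equal first.
  have hpig : ∃ k ∈ (Finset.univ : Finset C), (Nat.card C ^ 2 ^ L + 1) ^ L ≤
      (Y.filter fun y => χ {y} = k).card := by
    refine Finset.exists_le_card_fiber_of_mul_le_card_of_maps_to (fun _ _ => Finset.mem_univ _)
      ⟨χ ∅, Finset.mem_univ _⟩ (le_trans ?_ hY)
    rw [Finset.card_univ, ← Nat.card_eq_fintype_card, pow_succ, mul_comm]
    refine Nat.mul_le_mul_left _ (le_trans ?_ (Nat.le_succ _))
    exact Nat.le_self_pow (by positivity) _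
  obtain ⟨k, -, hk⟩ := hpig
  obtain ⟨E, hEY, hE, h⟩ := exists_endHomogeneous_aux χ L L ∅ _ (by simp) (by simp) (by
    intro A hA y hy y' hy'
    obtain rfl := Finset.subset_empty.1 hA
    exact (Finset.mem_filter.1 hy).2.trans (Finset.mem_filter.1 hy').2.symm) hk
  refine ⟨E, hEY.trans (Finset.filter_subset _ _), hE, ?_⟩
  simpa using h

theorem exists_homogeneous {C : Type} [Finite C] (m : ℕ) :
    ∀ (p : ℕ) (χ : Finset ℕ → C) (Y : Finset ℕ), ramseyBound (Nat.card C) m p ≤ Y.card →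
      ∃ H ⊆ Y, H.card = m ∧ ∃ k, ∀ A ⊆ H, A.card = p → χ A = k
  | 0, χ, Y, hY => by
    obtain ⟨H, hH, hc⟩ := Finset.exists_subset_card_eq hY
    refine ⟨H, hH, hc, χ ∅, fun A _ hA => ?_⟩
    rw [Finset.card_eq_zero.1 hA]
  | p + 1, χ, Y, hY => by
    classical
    obtain ⟨E, hEY, hEc, hE⟩ := exists_endHomogeneous χ _ Y hY
    have hne : E.Nonempty := Finset.card_pos.1 (by omega)
    set M := E.max' hne with hM
    have hME : M ∈ E := E.max'_mem hne
    obtain ⟨H, hHE, hHc, k, hk⟩ := exists_homogeneous m p (fun A => χ (insert M A)) (E.erase M)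
      (by rw [Finset.card_erase_of_mem hME]; omega)
    have hlt : ∀ a ∈ H, a ∈ E ∧ a < M := by
      intro a ha
      have ha' := Finset.mem_erase.1 (hHE ha)
      exact ⟨ha'.2, lt_of_le_of_ne (E.le_max' a ha'.2) ha'.1⟩
    refine ⟨H, fun a ha => hEY (hlt a ha).1, hHc, k, fun B hB hBc => ?_⟩
    have hBne : B.Nonempty := Finset.card_pos.1 (by omega)
    set b := B.max' hBne with hb
    have hbB : b ∈ B := B.max'_mem hBne
    have hBb : insert b (B.erase b) = B := Finset.insert_erase hbB
    rw [← hk (B.erase b) ((Finset.erase_subset _ _).trans hB)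
      (by rw [Finset.card_erase_of_mem hbB]; omega), ← hBb, Finset.erase_insert_eq_erase,
      Finset.erase_idem]
    refine hE _ (fun a ha => (hlt a (hB (Finset.mem_of_mem_erase ha))).1) b (hlt b (hB hbB)).1 M
      hME ?_ ?_
    · intro a ha
      exact lt_of_le_of_ne (B.le_max' a (Finset.mem_of_mem_erase ha)) (Finset.ne_of_mem_erase ha)
    · intro a ha
      exact (hlt a (hB (Finset.mem_of_mem_erase ha))).2

/-- Ramsey's theorem for colourings of increasing sequences of length `p`. -/
theorem exists_homogeneous_seq {C : Type} [Finite C] (m p M : ℕ) (χ : (Fin p → ℕ) → C)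
    (hM : ramseyBound (Nat.card C) m p ≤ M) :
    ∃ h : ℕ → ℕ, StrictMonoOn h (Set.Iio m) ∧ (∀ i < m, h i < M) ∧
      ∀ a b : Fin p → ℕ, StrictMono a → StrictMono b → (∀ i, a i < m) → (∀ i, b i < m) →
        χ (h ∘ a) = χ (h ∘ b) := by
  classical
  let enum : Finset ℕ → Fin p → ℕ := fun A i => Nat.nth (· ∈ A) i
  obtain ⟨H, hHM, hHc, k, hk⟩ := exists_homogeneous m p (fun A => χ (enum A)) (Finset.range M)
    (by simpa using hM)
  let emb := H.orderEmbOfFin hHc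
  let h : ℕ → ℕ := fun i => if hi : i < m then emb ⟨i, hi⟩ else 0
  have hh : ∀ i (hi : i < m), h i = emb ⟨i, hi⟩ := fun i hi => dif_pos hi
  have hmono : StrictMonoOn h (Set.Iio m) := by
    intro i hi j hj hij
    rw [hh i hi, hh j hj]
    exact emb.strictMono hij
  have hmem : ∀ i < m, h i ∈ H := fun i hi => by
    rw [hh i hi]; exact H.orderEmbOfFin_mem hHc _
  refine ⟨h, hmono, fun i hi => Finset.mem_range.1 (hHM (hmem i hi)), ?_⟩
  have key : ∀ a : Fin p → ℕ, StrictMono a → (∀ i, a i < m) → χ (h ∘ a) = k := by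
    intro a ha ham
    have hs : StrictMono (h ∘ a) := fun i j hij => hmono (ham i) (ham j) (ha hij)
    set A := Finset.univ.image (h ∘ a) with hA
    have hAc : A.card = p := by
      rw [hA, Finset.card_image_of_injective _ hs.injective, Finset.card_univ, Fintype.card_fin]
    have hfin : (Set.ofPred (· ∈ A)).Finite := A.finite_toSet
    have henum : enum A = h ∘ a := by
      have h1 : StrictMono (enum A) := by
        intro i j hij
        refine Nat.nth_lt_nth_of_lt_card hfin hij ?_
        have : hfin.toFinset = A := by ext; simp
        rw [this, hAc]
        exact j.2
      have h2 : ∀ i, enum A i ∈ A := by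
        intro i
        refine Nat.nth_mem_of_lt_card hfin ?_
        have : hfin.toFinset = A := by ext; simp
        rw [this, hAc]
        exact i.2
      have e1 := Finset.orderEmbOfFin_unique hAc h2 h1
      have e2 := Finset.orderEmbOfFin_unique hAc
        (fun i => Finset.mem_image_of_mem _ (Finset.mem_univ i)) hs
      exact e1.trans e2.symm
    rw [← henum]
    refine hk A ?_ hAc
    intro x hx
    obtain ⟨i, -, rfl⟩ := Finset.mem_image.1 hx
    exact hmem _ (ham i)
  intro a b ha hb ham hbm
  rw [key a ha ham, key b hb hbm]

/-! ### Order-invariant algorithms -/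

/-- The algorithm that runs `A` with the identifier of rank `i` among those within distance `t`
(where `t` is the number of rounds) replaced by `h i`. As a vertex learns the ranks only while it
gathers the identifiers, `A` is run for all possible replacements `f` of identifiers in parallel,
and the right one is selected at the end. -/
def Algorithm.orderInvariant {Inp Out : Type} (A : Algorithm Inp Out ℕ) (h : ℕ → ℕ) :
    Algorithm Inp Out ℕ where
  State := Finset ℕ × ((ℕ → ℕ) → A.State)
  Msg := Finset ℕ × ((ℕ → ℕ) → A.Msg)
  init d i x := ({x}, fun f => A.init d i (f x))
  send s p := (s.1, fun f => A.send (s.2 f) p)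
  recv s d m := (s.1 ∪ Finset.univ.biUnion fun i => (m i).1,
    fun f => A.recv (s.2 f) d fun i => (m i).2 f)
  out s := A.out (s.2 fun i => h (Nat.count (· ∈ s.1) i))

section OrderInvariant

variable {Δ : ℕ} {Inp Out V : Type} {G : SimpleGraph V} {A : Algorithm Inp Out ℕ}

theorem Algorithm.PortOblivious.orderInvariant (hA : A.PortOblivious) (h : ℕ → ℕ) :
    (A.orderInvariant h).PortOblivious := by
  classical
  refine ⟨fun s i j => Prod.ext rfl (funext fun f => hA.1 _ _ _), fun s d m σ => Prod.ext ?_ ?_⟩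
  · ext a
    simp only [Algorithm.orderInvariant, Finset.mem_union, Finset.mem_biUnion, Finset.mem_univ,
      true_and]
    exact or_congr_right (σ.exists_congr fun _ => Iff.rfl)
  · exact funext fun f => hA.2 (s.2 f) d (fun i => (m i).2 f) σ

theorem mem_nbhd_comm {u v : V} {r : ℕ} : u ∈ nbhd G v r ↔ v ∈ nbhd G u r := by
  simp [nbhd, SimpleGraph.edist_comm]

theorem mem_nbhd_succ' {u v : V} {j : ℕ} : u ∈ nbhd G v (j + 1) ↔
    u ∈ nbhd G v j ∨ ∃ w, G.Adj v w ∧ u ∈ nbhd G w j := by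
  rw [mem_nbhd_comm, mem_nbhd_succ, mem_nbhd_comm]
  refine or_congr_right ⟨?_, ?_⟩
  · rintro ⟨w, hw, h⟩
    exact ⟨w, h.symm, mem_nbhd_comm.1 hw⟩
  · rintro ⟨w, h, hw⟩
    exact ⟨w, mem_nbhd_comm.1 hw, h.symm⟩

theorem Algorithm.orderInvariant_run_snd (h : ℕ → ℕ) (π : PortNumbering G) (inp : V → Inp)
    (x : V → ℕ) (f : ℕ → ℕ) : ∀ (t : ℕ) (v : V),
      ((A.orderInvariant h).run π inp x t v).2 f = A.run π inp (f ∘ x) t v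
  | 0, v => rfl
  | t + 1, v => by
    change A.recv _ _ _ = A.recv _ _ _
    rw [Algorithm.orderInvariant_run_snd h π inp x f t v]
    congr 1
    funext i
    exact congrArg (fun s => A.send s _) (Algorithm.orderInvariant_run_snd h π inp x f t _)

theorem Algorithm.mem_orderInvariant_run_fst (h : ℕ → ℕ) (π : PortNumbering G) (inp : V → Inp)
    (x : V → ℕ) (a : ℕ) : ∀ (t : ℕ) (v : V),
      a ∈ ((A.orderInvariant h).run π inp x t v).1 ↔ ∃ u ∈ nbhd G v t, x u = a
  | 0, v => by
    change a ∈ ({x v} : Finset ℕ) ↔ _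
    simp [mem_nbhd_zero, eq_comm]
  | t + 1, v => by
    change a ∈ ((A.orderInvariant h).run π inp x t v).1 ∪ Finset.univ.biUnion (fun i =>
      ((A.orderInvariant h).run π inp x t (π.nbr v i)).1) ↔ _
    simp only [Finset.mem_union, Finset.mem_biUnion, Finset.mem_univ, true_and,
      Algorithm.mem_orderInvariant_run_fst h π inp x a t, mem_nbhd_succ']
    constructor
    · rintro (⟨u, hu, rfl⟩ | ⟨i, u, hu, rfl⟩)
      · exact ⟨u, .inl hu, rfl⟩
      · exact ⟨u, .inr ⟨_, (π.nbr v i).2, hu⟩, rfl⟩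
    · rintro ⟨u, hu | ⟨w, hw, hu⟩, rfl⟩
      · exact .inl ⟨u, hu, rfl⟩
      · obtain ⟨i, hi⟩ := (π.nbr v).surjective ⟨w, hw⟩
        exact .inr ⟨i, u, by rwa [hi], rfl⟩

theorem Matches.congr {ports : Bool} {π : PortNumbering G} {inp : V → Inp} {out out' : V → Out}
    {v : V} {r : ℕ} {C : Config Inp Out} (h : ∀ u ∈ nbhd G v r, out u = out' u)
    (hC : Matches ports G π inp out v r C) : Matches ports G π inp out' v r C := by
  obtain ⟨e, h1, h2, h3⟩ := hC
  exact ⟨e, h1, fun u => ⟨(h2 u).1, (h2 u).2.1, (h2 u).2.2.trans (h u u.2)⟩, h3⟩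

/-- The colour of a sequence `y` of `p` identifiers: the outputs of `A` after `T` rounds in
all local views whose vertices hold the identifiers `y 0, …, y (p - 1)`. -/
def Algorithm.viewColor (A : Algorithm Inp Out ℕ) (Δ T p : ℕ) (y : Fin p → ℕ) :
    LocalView Δ Inp (Fin p) × Fin p → Out :=
  fun N => A.out (N.1.run A y T N.2)

/-- On identifiers taken from a homogeneous set, the output at `u` depends only on the ranks of the
identifiers near `u`. -/
theorem Algorithm.output_eq_of_homogeneous {T p : ℕ} {h : ℕ → ℕ}
    (hh : ∀ a b : Fin p → ℕ, StrictMono a → StrictMono b → (∀ i, a i < 2 * p) →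
      (∀ i, b i < 2 * p) → A.viewColor Δ T p (h ∘ a) = A.viewColor Δ T p (h ∘ b))
    {π : PortNumbering G} (hΔ : ∀ u, π.deg u ≤ Δ) (inp : V → Inp) {x : V → ℕ}
    (hx : Function.Injective x) {u : V} {F F' : Finset ℕ}
    (hF : ∀ a, a ∈ F ↔ ∃ w ∈ nbhd G u T, x w = a) (hFF' : F ⊆ F') (hF' : F'.card ≤ p) :
    A.output π inp (fun w => h (Nat.count (· ∈ F) (x w))) T u =
      A.output π inp (fun w => h (Nat.count (· ∈ F') (x w))) T u := by
  classical
  have hFp : F.card ≤ p := (Finset.card_le_card hFF').trans hF'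
  have hcard : ∀ E : Finset ℕ, ∀ hfin : (Set.ofPred (· ∈ E)).Finite, hfin.toFinset = E :=
    fun E hfin => by ext; simp
  have hcount : ∀ E : Finset ℕ, ∀ a ∈ E, Nat.count (· ∈ E) a < E.card := by
    intro E a ha
    have hfin : (Set.ofPred (· ∈ E)).Finite := E.finite_toSet
    have := Nat.count_lt_card hfin ha
    rwa [hcard] at this
  have hxF : ∀ w ∈ nbhd G u T, x w ∈ F := fun w hw => (hF _).2 ⟨w, hw, rfl⟩
  have hp : 0 < p := by
    have := hcount F _ (hxF u (mem_nbhd_self G u T))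
    omega
  let e : V → Fin p := fun w => ⟨Nat.count (· ∈ F) (x w) % p, Nat.mod_lt _ hp⟩
  have he : ∀ w ∈ nbhd G u T, (e w : ℕ) = Nat.count (· ∈ F) (x w) := fun w hw =>
    Nat.mod_eq_of_lt ((hcount F _ (hxF w hw)).trans_le hFp)
  have heinj : Set.InjOn e (nbhd G u T) := by
    intro w hw w' hw' hww'
    have h1 : Nat.count (· ∈ F) (x w) = Nat.count (· ∈ F) (x w') := by
      rw [← he w hw, ← he w' hw', hww']
    exact hx (Nat.count_injective (hxF w hw) (hxF w' hw') h1)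
  obtain ⟨N, hN⟩ := exists_isView hΔ inp heinj
  -- The ranks in `E` of the elements of `F`, continued beyond the end of `E`.
  let a : Finset ℕ → Fin p → ℕ := fun E j =>
    if (j : ℕ) < F.card then Nat.count (· ∈ E) (Nat.nth (· ∈ F) j) else p + j
  have hnth : ∀ j < F.card, Nat.nth (· ∈ F) j ∈ F := by
    intro j hj
    refine Nat.nth_mem_of_lt_card (p := (· ∈ F)) F.finite_toSet ?_
    rwa [hcard]
  have ha : ∀ E : Finset ℕ, F ⊆ E → E.card ≤ p → StrictMono (a E) ∧ ∀ i, a E i < 2 * p := by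
    intro E hFE hE
    have hlt : ∀ j < F.card, Nat.count (· ∈ E) (Nat.nth (· ∈ F) j) < p := fun j hj =>
      (hcount E _ (hFE (hnth j hj))).trans_le hE
    constructor
    · intro i j hij
      have hij' : (i : ℕ) < j := hij
      simp only [a]
      by_cases hj : (j : ℕ) < F.card
      · rw [if_pos hj, if_pos (by omega)]
        refine Nat.count_strict_mono (hFE (hnth i (by omega))) ?_
        refine Nat.nth_lt_nth_of_lt_card (p := (· ∈ F)) F.finite_toSet hij' ?_
        rwa [hcard]
      · rw [if_neg hj]
        split_ifs with hi
        · have := hlt i hi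
          omega
        · omega
    · intro i
      have := i.2
      simp only [a]
      split_ifs with hi
      · have := hlt i hi
        omega
      · omega
  have key : ∀ E : Finset ℕ, F ⊆ E → E.card ≤ p →
      A.output π inp (fun w => h (Nat.count (· ∈ E) (x w))) T u =
        A.viewColor Δ T p (h ∘ a E) (N, e u) := by
    intro E hFE hE
    simp only [Algorithm.output, Algorithm.viewColor]
    rw [hN.run_eq A (y := h ∘ a E) ?_ T 0 u (mem_nbhd_self _ _ _) (by omega)]
    intro w hw
    simp only [Function.comp_apply, a]
    rw [he w hw, if_pos (hcount F _ (hxF w hw)), Nat.nth_count (hxF w hw)]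
  rw [key F subset_rfl hFp, key F' hFF' hF', hh _ _ (ha F subset_rfl hFp).1 (ha F' hFF' hF').1
    (ha F subset_rfl hFp).2 (ha F' hFF' hF').2]

/-- Within `T` rounds, `A` produces an acceptable output at `v` whenever the identifiers within
distance `R` of `v` are distinct and less than `M`, in all `n`-vertex networks of the class. -/
def LocallySolves (𝒢 : GraphClass) (ports : Bool) (P : LCL Inp Out) (A : Algorithm Inp Out ℕ)
    (T R M n : ℕ) : Prop :=
  ∀ (G : SimpleGraph (Fin n)), 𝒢 n G → ∀ (π : PortNumbering G) (inp : Fin n → Inp) (v : Fin n)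
    (x : Fin n → ℕ), Set.InjOn x (nbhd G v R) → (∀ u ∈ nbhd G v R, x u < M) →
      ∃ C ∈ P.configs, Matches ports G π inp (A.output π inp x T) v P.radius C

instance LocalView.finite {W : Type} [Finite W] [Finite Inp] : Finite (LocalView Δ Inp W) :=
  Finite.of_injective (fun N => (N.deg, N.inp, N.nbr, N.port)) fun N N' h => by
    simp only [Prod.mk.injEq] at h
    exact LocalView.ext h.1 h.2.1 h.2.2.1 h.2.2.2

/-- If `A` copes with enough identifiers around every vertex, then restricting it to identifiers
on which it is order-invariant gives an algorithm for arbitrary identifiers. -/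
theorem exists_valid_of_locallySolves [Finite Inp] [Finite Out] (ports : Bool) (P : LCL Inp Out)
    (A : Algorithm Inp Out ℕ) {T R p M : ℕ} (hR : P.radius + T ≤ R)
    (hM : ramseyBound (Nat.card (LocalView Δ Inp (Fin p) × Fin p → Out)) (2 * p) p ≤ M) :
    ∃ B : Algorithm Inp Out ℕ, (A.PortOblivious → B.PortOblivious) ∧
      ∀ (𝒢 : GraphClass) (n : ℕ), LocallySolves 𝒢 ports P A T R M n →
        ∀ (G : SimpleGraph (Fin n)), 𝒢 n G → (∀ v, (nbhd G v R).ncard ≤ p) →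
          ∀ (π : PortNumbering G) (inp : Fin n → Inp) (x : Fin n → ℕ), (∀ u, π.deg u ≤ Δ) →
            Function.Injective x → P.Valid ports G π inp (B.output π inp x T) := by
  classical
  obtain ⟨h, hmono, hlt, hh⟩ := exists_homogeneous_seq (2 * p) p M (A.viewColor Δ T p) hM
  refine ⟨A.orderInvariant h, fun hA => hA.orderInvariant h, ?_⟩
  intro 𝒢 n hA G hG hball π inp x hΔ hx v
  have hids : ∀ (u : Fin n) (s : ℕ), ∃ F : Finset ℕ, (∀ a, a ∈ F ↔ ∃ w ∈ nbhd G u s, x w = a) ∧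
      F.card = (nbhd G u s).ncard := by
    intro u s
    refine ⟨(nbhd G u s).toFinite.toFinset.image x, fun a => by simp, ?_⟩
    rw [Finset.card_image_of_injective _ hx, Set.ncard_eq_toFinset_card]
  obtain ⟨F, hF, hFc⟩ := hids v R
  have hFp : F.card ≤ p := hFc ▸ hball v
  have hcount : ∀ a ∈ F, Nat.count (· ∈ F) a < 2 * p := by
    intro a ha
    have := Nat.count_lt_card (p := (· ∈ F)) F.finite_toSet ha
    rw [show F.finite_toSet.toFinset = F by ext; simp] at this
    omega
  have hxF : ∀ w ∈ nbhd G v R, x w ∈ F := fun w hw => (hF _).2 ⟨w, hw, rfl⟩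
  obtain ⟨C, hC, hm⟩ := hA G hG π inp v (fun w => h (Nat.count (· ∈ F) (x w)))
    (fun w hw w' hw' hww' => hx (Nat.count_injective (hxF w hw) (hxF w' hw')
      (hmono.injOn (hcount _ (hxF w hw)) (hcount _ (hxF w' hw')) hww')))
    fun w hw => hlt _ (hcount _ (hxF w hw))
  refine ⟨C, hC, hm.congr fun u hu => ?_⟩
  have hE := fun a => Algorithm.mem_orderInvariant_run_fst (A := A) h π inp x a T u
  have h1 : (A.orderInvariant h).output π inp x T u = A.output π inp (fun w => h (Nat.count
      (· ∈ ((A.orderInvariant h).run π inp x T u).1) (x w))) T u :=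
    congrArg A.out (Algorithm.orderInvariant_run_snd h π inp x _ T u)
  rw [h1]
  refine (A.output_eq_of_homogeneous hh hΔ inp hx hE ?_ hFp).symm
  intro a ha
  obtain ⟨w, hw, rfl⟩ := (hE a).1 ha
  exact hxF w (nbhd_mono hR (mem_nbhd_trans hu hw))

end OrderInvariant

/-! ### Algorithms with local guarantees -/

/-- The neighbourhood of radius `R + 1` of every vertex of an `n`-vertex graph of the class occurs,
up to the edges at its boundary, in an `m`-vertex graph of the class. -/
def Embeds (𝒢 : GraphClass) (R n m : ℕ) : Prop :=
  ∀ G : SimpleGraph (Fin n), 𝒢 n G → ∀ v : Fin n,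
    ∃ (G' : SimpleGraph (Fin m)) (ψ : Fin n → Fin m), 𝒢 m G' ∧ Set.InjOn ψ (nbhd G v (R + 1)) ∧
      ∀ u ∈ nbhd G v R, ψ '' G.neighborSet u = G'.neighborSet (ψ u)

/-- The algorithm `A` with private values computed by `f` from given ones. -/
def Algorithm.comap {Inp Out X Y : Type} (A : Algorithm Inp Out X) (f : Y → X) :
    Algorithm Inp Out Y where
  State := A.State
  Msg := A.Msg
  init d i y := A.init d i (f y)
  send := A.send
  recv := A.recv
  out := A.out

theorem Algorithm.comap_run {Inp Out X Y V : Type} (A : Algorithm Inp Out X) (f : Y → X)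
    {G : SimpleGraph V} (π : PortNumbering G) (inp : V → Inp) (y : V → Y) :
    ∀ (t : ℕ) (v : V), (A.comap f).run π inp y t v = A.run π inp (f ∘ y) t v
  | 0, _ => rfl
  | t + 1, v => by
    change A.recv _ _ _ = A.recv _ _ _
    rw [A.comap_run f π inp y t v]
    congr 1
    funext i
    exact congrArg (fun s => A.send s _) (A.comap_run f π inp y t _)

theorem Algorithm.comap_output {Inp Out X Y V : Type} (A : Algorithm Inp Out X) (f : Y → X)
    {G : SimpleGraph V} (π : PortNumbering G) (inp : V → Inp) (y : V → Y) (t : ℕ) :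
    (A.comap f).output π inp y t = A.output π inp (f ∘ y) t :=
  funext fun v => congrArg A.out (A.comap_run f π inp y t v)

section Local

variable {Δ : ℕ} {Inp Out V V' W X : Type} {N : LocalView Δ Inp W} {e : V → W}
  {G : SimpleGraph V} {π : PortNumbering G} {inp : V → Inp} {v : V} {R : ℕ}
  {e' : V' → W} {G' : SimpleGraph V'} {π' : PortNumbering G'} {inp' : V' → Inp} {v' : V'}

/-- If two vertices have the same local view, then an algorithm that succeeds at one of them
succeeds at the other. -/
theorem IsView.matches_output (h : IsView N e G π inp v R) (h' : IsView N e' G' π' inp' v' R)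
    (hv : e v = e' v') (A : Algorithm Inp Out X) {x : V → X} {x' : V' → X} (y : W → X)
    (hx : ∀ u ∈ nbhd G v R, x u = y (e u)) (hx' : ∀ u ∈ nbhd G' v' R, x' u = y (e' u))
    {ports : Bool} {r T : ℕ} (hR : r + T + 1 ≤ R) {C : Config Inp Out}
    (hC : Matches ports G' π' inp' (A.output π' inp' x' T) v' r C) :
    Matches ports G π inp (A.output π inp x T) v r C := by
  refine (h.mono (mem_nbhd_self G v 0) (by omega)).matches_transfer
    (h'.mono (mem_nbhd_self G' v' 0) (by omega)) hv ?_ hC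
  intro u hu u' hu' he
  simp only [Algorithm.output]
  rw [h.run_eq A hx T r u hu (by omega), h'.run_eq A hx' T r u' hu' (by omega), he]

/-- An algorithm for graphs with `m` vertices solves the problem locally on graphs of any size in
which no vertex can tell the difference. -/
theorem locallySolves_of_det {𝒢 : GraphClass} {ports : Bool} {P : LCL Inp Out} {k m T n : ℕ}
    (hk : 1 ≤ k) {A : Algorithm Inp Out ℕ}
    (hA : ∀ (G : SimpleGraph (Fin m)), 𝒢 m G → ∀ (π : PortNumbering G) (inp : Fin m → Inp)
      (id : Fin m → ℕ), Function.Injective id → (∀ v, id v < m ^ k) →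
      P.Valid ports G π inp (A.output π inp id T))
    (hR : P.radius + T + 1 ≤ R) (hemb : Embeds 𝒢 R n m) (hΔ : ∀ G, 𝒢 n G → boundedDegree Δ n G) :
    LocallySolves 𝒢 ports P A T R m n := by
  classical
  intro G hG π inp v x hx hxm
  obtain ⟨N, hN⟩ := exists_isView (π := π) (e := id) (v := v) (R := R)
    (fun u => (π.deg_eq_ncard u).trans_le (hΔ G hG u)) inp (Set.injOn_id _)
  obtain ⟨G', ψ, hG', hψ, hnb⟩ := hemb G hG v
  obtain ⟨π', inp', e', hN', hv'⟩ := hN.exists_map G' ψ hψ hnb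
  have hmem : ∀ a ∈ nbhd G' (ψ v) R, e' a ∈ nbhd G v R := by
    intro a ha
    obtain ⟨u, hu, he⟩ := hN'.exists_mem_nbhd hN hv' R le_rfl a ha
    exact he ▸ hu
  obtain ⟨g, hg⟩ := Finset.exists_equiv_extend_of_card_eq (t := Finset.range m) (by simp)
    (s := (nbhd G' (ψ v) R).toFinite.toFinset) (f := fun a => x (e' a)) (by
      intro i hi
      obtain ⟨a, ha, rfl⟩ := Finset.mem_image.1 hi
      exact Finset.mem_range.2 (hxm _ (hmem a (by simpa using ha)))) (by
      intro a ha b hb hab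
      have ha' : a ∈ nbhd G' (ψ v) R := by simpa using ha
      have hb' : b ∈ nbhd G' (ψ v) R := by simpa using hb
      exact hN'.inj ha' hb' (hx (hmem a ha') (hmem b hb') hab))
  obtain ⟨C, hC, hm⟩ := hA G' hG' π' inp' (fun a => g a)
    (Subtype.val_injective.comp g.injective)
    (fun a => (Finset.mem_range.1 (g a).2).trans_le (Nat.le_self_pow (by omega) m)) (ψ v)
  exact ⟨C, hC, hN.matches_output hN' hv'.symm A x (fun u _ => rfl)
    (fun u hu => hg u (by simpa using hu)) hR hm⟩

/-- Random bits can be fixed as a function of identifiers from a range of size `M`, provided that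
there are fewer than `m` local views with such identifiers: each of them is unsuccessful with
probability at most `1 / m`. The function does not depend on the size `n` of the network. -/
theorem exists_locallySolves_of_rand [Finite Inp] {𝒢 : GraphClass} {ports : Bool}
    {P : LCL Inp Out} {m T p M : ℕ} {A : Algorithm Inp Out (ℕ → Bool)}
    (hA : ∀ (G : SimpleGraph (Fin m)), 𝒢 m G → ∀ (π : PortNumbering G) (inp : Fin m → Inp),
      Measure.pi (fun _ : Fin m => fairBits)
        {ω | ¬ P.Valid ports G π inp (A.output π inp ω T)} ≤ (m : ENNReal)⁻¹)
    (hR : P.radius + T + 1 ≤ R)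
    (hm : Nat.card (LocalView Δ Inp (Fin p) × Fin p × (Fin p → Fin M)) < m) :
    ∃ ρ : ℕ → ℕ → Bool, ∀ n, Embeds 𝒢 R n m → (∀ G, 𝒢 n G → boundedDegree Δ n G) →
      (∀ G, 𝒢 n G → ∀ v, (nbhd G v R).ncard ≤ p) →
      LocallySolves 𝒢 ports P (A.comap ρ) T R M n := by
  classical
  have hbad : ∀ τ : LocalView Δ Inp (Fin p) × Fin p × (Fin p → Fin M),
      ∃ B : Set (ℕ → ℕ → Bool), Measure.infinitePi (fun _ : ℕ => fairBits) B ≤ (m : ENNReal)⁻¹ ∧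
        ∀ ρ ∉ B, ∀ (n : ℕ) (G : SimpleGraph (Fin n)) (π : PortNumbering G) (inp : Fin n → Inp)
          (v : Fin n) (e : Fin n → Fin p), IsView τ.1 e G π inp v R → e v = τ.2.1 →
          Set.InjOn (fun u => τ.2.2 (e u)) (nbhd G v R) →
          (∃ (G' : SimpleGraph (Fin m)) (ψ : Fin n → Fin m), 𝒢 m G' ∧
            Set.InjOn ψ (nbhd G v (R + 1)) ∧
            ∀ u ∈ nbhd G v R, ψ '' G.neighborSet u = G'.neighborSet (ψ u)) →
          ∃ C ∈ P.configs,
            Matches ports G π inp (A.output π inp (fun u => ρ (τ.2.2 (e u))) T) v P.radius C := by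
    rintro ⟨N, c, y⟩
    by_cases hreal : ∃ (G' : SimpleGraph (Fin m)) (π' : PortNumbering G') (inp' : Fin m → Inp)
        (v' : Fin m) (e' : Fin m → Fin p), 𝒢 m G' ∧ IsView N e' G' π' inp' v' R ∧ e' v' = c ∧
          Set.InjOn (fun u => y (e' u)) (nbhd G' v' R)
    · obtain ⟨G', π', inp', v', e', hG', hN', hv', hy'⟩ := hreal
      -- The vertices of `G'` outside the view use the bits of identifiers that do not occur in it.
      let κ : Fin m → ℕ := fun a => if a ∈ nbhd G' v' R then (y (e' a) : ℕ) else M + a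
      have hκ : Function.Injective κ := by
        intro a b hab
        simp only [κ] at hab
        split_ifs at hab with ha hb hb
        · exact hy' ha hb (Fin.ext hab)
        · have := (y (e' a)).2
          omega
        · have := (y (e' b)).2
          omega
        · exact Fin.ext (by omega)
      refine ⟨(fun ρ a => ρ (κ a)) ⁻¹' {ω | ¬ P.Valid ports G' π' inp' (A.output π' inp' ω T)},
        ?_, ?_⟩
      · refine (Measure.le_map_apply
          (measurable_pi_lambda _ fun a => measurable_pi_apply (κ a)).aemeasurable _).trans ?_
        rw [Measure.map_infinitePi_infinitePi_of_inj hκ, Measure.infinitePi_eq_pi]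
        exact hA G' hG' π' inp'
      · intro ρ hρ n G π inp v e hN hv _ _
        have hval : P.Valid ports G' π' inp' (A.output π' inp' (fun a => ρ (κ a)) T) := by
          by_contra hcon
          exact hρ hcon
        obtain ⟨C, hC, hm⟩ := hval v'
        exact ⟨C, hC, hN.matches_output hN' (hv.trans hv'.symm) A (fun w => ρ (y w))
          (fun u _ => rfl) (fun u hu => by simp only [κ, if_pos hu]) hR hm⟩
    · refine ⟨∅, by simp, ?_⟩
      rintro ρ - n G π inp v e hN hv hy ⟨G', ψ, hG', hψ, hnb⟩
      obtain ⟨π', inp', e', hN', hv'⟩ := hN.exists_map G' ψ hψ hnb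
      refine absurd ⟨G', π', inp', ψ v, e', hG', hN', hv'.trans hv, ?_⟩ hreal
      intro a ha b hb hab
      obtain ⟨u, hu, heu⟩ := hN'.exists_mem_nbhd hN hv' R le_rfl a ha
      obtain ⟨w, hw, hew⟩ := hN'.exists_mem_nbhd hN hv' R le_rfl b hb
      have huw : u = w := hy hu hw (by simpa only [heu, hew] using hab)
      exact hN'.inj ha hb (by rw [← heu, ← hew, huw])
  choose B hB hgood using hbad
  -- The union bound: some choice of the bits is good for all local views at once.
  have hex : ∃ ρ, ρ ∉ ⋃ τ, B τ := by
    by_contra! hcon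
    have huniv : ⋃ τ, B τ = Set.univ := Set.eq_univ_of_forall hcon
    have := Fintype.ofFinite (LocalView Δ Inp (Fin p) × Fin p × (Fin p → Fin M))
    have h1 := measure_iUnion_fintype_le (Measure.infinitePi (fun _ : ℕ => fairBits)) B
    rw [huniv, measure_univ] at h1
    have h2 := h1.trans (Finset.sum_le_sum fun τ _ => hB τ)
    rw [Finset.sum_const, Finset.card_univ, ← Nat.card_eq_fintype_card, nsmul_eq_mul,
      ← div_eq_mul_inv] at h2
    have hm0 : (m : ENNReal) ≠ 0 := by
      have : m ≠ 0 := by omega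
      exact_mod_cast this
    rw [ENNReal.le_div_iff_mul_le (.inl hm0) (.inl (ENNReal.natCast_ne_top m)), one_mul] at h2
    have h3 : m ≤ Nat.card (LocalView Δ Inp (Fin p) × Fin p × (Fin p → Fin M)) := by
      exact_mod_cast h2
    omega
  obtain ⟨ρ, hρ⟩ := hex
  refine ⟨ρ, ?_⟩
  intro n hemb hΔ hball G hG π inp v x hx hxM
  have hne : Nonempty (Fin n) := ⟨v⟩
  have hp : 0 < p := lt_of_lt_of_le
    ((Set.ncard_pos (Set.toFinite _)).2 ⟨v, mem_nbhd_self G v R⟩) (hball G hG v)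
  have hinj : ∃ e : Fin n → Fin p, Set.InjOn e (nbhd G v R) := by
    have : Nonempty (Fin p) := ⟨⟨0, hp⟩⟩
    obtain ⟨e, -, he⟩ := (Set.toFinite (nbhd G v R)).exists_injOn_of_encard_le
      (t := (Set.univ : Set (Fin p))) (by
        rw [← Set.Finite.cast_ncard_eq (Set.toFinite _), Set.encard_univ,
          ENat.card_eq_coe_fintype_card, Fintype.card_fin]
        exact_mod_cast hball G hG v)
    exact ⟨e, he⟩
  obtain ⟨e, he⟩ := hinj
  let y : Fin p → Fin M := fun w =>
    if hw : x (Function.invFunOn e (nbhd G v R) w) < M then ⟨_, hw⟩ else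
      ⟨x v, hxM v (mem_nbhd_self _ _ _)⟩
  have hy : ∀ u ∈ nbhd G v R, (y (e u) : ℕ) = x u := by
    intro u hu
    have h1 : Function.invFunOn e (nbhd G v R) (e u) = u := he.leftInvOn_invFunOn hu
    simp only [y, h1, dif_pos (hxM u hu)]
  obtain ⟨N, hN⟩ := exists_isView (π := π)
    (fun u => (π.deg_eq_ncard u).trans_le (hΔ G hG u)) inp he
  obtain ⟨C, hC, hm⟩ := hgood (N, e v, y) ρ (fun h => hρ (Set.mem_iUnion.2 ⟨_, h⟩)) n G π inp v e hN
    rfl (fun u hu w hw huw => hx hu hw (by rw [← hy u hu, ← hy w hw]; exact congrArg _ huw))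
    (hemb G hG v)
  refine ⟨C, hC, ?_⟩
  rw [Algorithm.comap_output]
  exact hN.matches_output hN rfl A (fun w => ρ (y w)) (fun u hu => by simp [hy u hu])
    (fun u hu => rfl) hR hm

end Local

/-! ### Random identifiers -/

theorem fairBits_prefix (ℓ : ℕ) (c : ℕ → Bool) :
    fairBits {b | ∀ i < ℓ, b i = c i} = (2 ^ ℓ : ENNReal)⁻¹ := by
  have h1 : {b : ℕ → Bool | ∀ i < ℓ, b i = c i} = Set.pi (Finset.range ℓ) fun i => {c i} := by
    ext b
    simp
  rw [h1, fairBits, Measure.infinitePi_pi _ fun i _ => measurableSet_singleton _]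
  have h2 : ∀ i, (PMF.uniformOfFintype Bool).toMeasure {c i} = (2 : ENNReal)⁻¹ := by
    intro i
    rw [PMF.toMeasure_apply_singleton _ _ (measurableSet_singleton _)]
    simp
  rw [Finset.prod_congr rfl fun i _ => h2 i, Finset.prod_const, Finset.card_range,
    ENNReal.inv_pow]

/-- The first `ℓ` bits of a sequence, as a number. -/
noncomputable def prefixCode (ℓ : ℕ) (b : ℕ → Bool) : ℕ :=
  Fintype.equivFin (Fin ℓ → Bool) fun i => b i

theorem prefixCode_eq_iff {ℓ : ℕ} {b c : ℕ → Bool} :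
    prefixCode ℓ b = prefixCode ℓ c ↔ ∀ i < ℓ, b i = c i := by
  rw [prefixCode, prefixCode, Fin.val_inj, EmbeddingLike.apply_eq_iff_eq, funext_iff]
  exact ⟨fun h i hi => h ⟨i, hi⟩, fun h i => h i i.2⟩

theorem measurable_prefixCode (ℓ : ℕ) : Measurable (prefixCode ℓ) := by
  have h1 : Measurable fun f : Fin ℓ → Bool => (Fintype.equivFin (Fin ℓ → Bool) f : ℕ) :=
    measurable_of_finite _
  exact h1.comp (measurable_pi_lambda _ fun i => measurable_pi_apply _)

theorem measure_prefixCode_eq {n : ℕ} (ℓ : ℕ) {u v : Fin n} (huv : u ≠ v) :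
    Measure.pi (fun _ : Fin n => fairBits) {ω | prefixCode ℓ (ω u) = prefixCode ℓ (ω v)} =
      (2 ^ ℓ : ENNReal)⁻¹ := by
  have hm : MeasurableSet {p : (ℕ → Bool) × (ℕ → Bool) | prefixCode ℓ p.1 = prefixCode ℓ p.2} :=
    measurableSet_eq_fun ((measurable_prefixCode ℓ).comp measurable_fst)
      ((measurable_prefixCode ℓ).comp measurable_snd)
  have hmap := Measure.infinitePi_map_eval_prod (P := fun _ : Fin n => fairBits) huv
  rw [Measure.infinitePi_eq_pi] at hmap
  have h1 : {ω : Fin n → ℕ → Bool | prefixCode ℓ (ω u) = prefixCode ℓ (ω v)} =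
      (fun ω => (ω u, ω v)) ⁻¹' {p | prefixCode ℓ p.1 = prefixCode ℓ p.2} := rfl
  rw [h1, ← Measure.map_apply ((measurable_pi_apply u).prodMk (measurable_pi_apply v)) hm, hmap,
    Measure.prod_apply hm]
  have h2 : ∀ c : ℕ → Bool, fairBits (Prod.mk c ⁻¹'
      {p | prefixCode ℓ p.1 = prefixCode ℓ p.2}) = (2 ^ ℓ : ENNReal)⁻¹ := by
    intro c
    rw [← fairBits_prefix ℓ c]
    congr 1
    ext b
    simp only [Set.mem_preimage, Set.mem_ofPred_eq, prefixCode_eq_iff]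
    exact forall₂_congr fun i _ => eq_comm
  simp_rw [h2]
  simp

/-- By a union bound over pairs, as `n ^ 3 ≤ 2 ^ (3 * n)`. -/
theorem measure_prefixCode_not_injective (n : ℕ) :
    Measure.pi (fun _ : Fin n => fairBits)
      {ω | ¬ Function.Injective fun v => prefixCode (3 * n) (ω v)} ≤ (n : ENNReal)⁻¹ := by
  classical
  have hsub : {ω : Fin n → ℕ → Bool | ¬ Function.Injective fun v => prefixCode (3 * n) (ω v)} ⊆
      ⋃ p ∈ (Finset.univ : Finset (Fin n)).offDiag,
        {ω | prefixCode (3 * n) (ω p.1) = prefixCode (3 * n) (ω p.2)} := by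
    intro ω hω
    simp only [Set.mem_ofPred_eq, Function.Injective, not_forall] at hω
    obtain ⟨u, v, h, huv⟩ := hω
    exact Set.mem_biUnion (x := (u, v)) (by simp [huv]) h
  refine (measure_mono hsub).trans ((measure_biUnion_finset_le _ _).trans ?_)
  rw [Finset.sum_congr rfl fun p hp => measure_prefixCode_eq (3 * n) (Finset.mem_offDiag.1 hp).2.2,
    Finset.sum_const, nsmul_eq_mul]
  have hcard : (Finset.univ : Finset (Fin n)).offDiag.card ≤ n * n := by
    rw [Finset.offDiag_card]
    simp
  rcases Nat.eq_zero_or_pos n with rfl | hn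
  · simp
  have hn0 : (n : ENNReal) ≠ 0 := by exact_mod_cast hn.ne'
  rw [ENNReal.le_inv_iff_mul_le]
  have h2 : n * n * n ≤ 2 ^ (3 * n) := by
    have := (Nat.lt_two_pow_self (n := n)).le
    calc n * n * n ≤ 2 ^ n * 2 ^ n * 2 ^ n := by gcongr
      _ = 2 ^ (3 * n) := by ring
  rw [mul_assoc, mul_comm _ (n : ENNReal), ← mul_assoc, ← div_eq_mul_inv]
  refine ENNReal.div_le_of_le_mul ?_
  rw [one_mul]
  exact_mod_cast (Nat.mul_le_mul_right n hcard).trans h2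

/-! ### Solvability -/

section Solvable

variable {Inp Out : Type} {𝒢 : GraphClass} {ports : Bool} {P : LCL Inp Out} {n T : ℕ}
  {B : Algorithm Inp Out ℕ}

/-- Identifiers drawn at random are distinct with sufficient probability. -/
theorem randSolvable_of_forall_valid [Finite Out] (hB : ports = false → B.PortOblivious)
    (h : ∀ (G : SimpleGraph (Fin n)), 𝒢 n G → ∀ (π : PortNumbering G) (inp : Fin n → Inp)
      (x : Fin n → ℕ), Function.Injective x → P.Valid ports G π inp (B.output π inp x T)) :
    RandSolvable 𝒢 ports P n T := by
  refine ⟨B.comap (prefixCode (3 * n)), fun hp => hB hp, fun G hG π inp => ⟨fun v o => ?_, ?_⟩⟩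
  · have h1 : Measurable fun ω : Fin n → ℕ → Bool => fun v => prefixCode (3 * n) (ω v) :=
      measurable_pi_lambda _ fun v => (measurable_prefixCode _).comp (measurable_pi_apply v)
    have h2 : {ω : Fin n → ℕ → Bool | (B.comap (prefixCode (3 * n))).output π inp ω T v = o} =
        (fun ω v => prefixCode (3 * n) (ω v)) ⁻¹' {x | B.output π inp x T v = o} := by
      ext ω
      simp only [Algorithm.comap_output, Set.mem_preimage, Set.mem_ofPred_eq]
      rfl
    rw [h2]
    exact h1 (Set.to_countable _).measurableSet
  · refine (measure_mono ?_).trans (measure_prefixCode_not_injective n)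
    intro ω hω hinj
    apply hω
    rw [Algorithm.comap_output]
    exact h G hG π inp _ hinj

theorem exists_solvable_of_detComplexity_le {k t : ℕ} (h : detComplexity 𝒢 ports P k n ≤ t) :
    ∃ t' ≤ t, DetSolvable 𝒢 ports P k n t' := by
  by_contra! hcon
  have h1 : ((t + 1 : ℕ) : ℕ∞) ≤ detComplexity 𝒢 ports P k n := by
    refine le_iInf₂ fun s hs => ?_
    have : t < s := by
      by_contra! hst
      exact hcon s hst hs
    exact_mod_cast this
  have h2 : t + 1 ≤ t := by exact_mod_cast h1.trans h
  omega

theorem exists_solvable_of_randComplexity_le {t : ℕ} (h : randComplexity 𝒢 ports P n ≤ t) :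
    ∃ t' ≤ t, RandSolvable 𝒢 ports P n t' := by
  by_contra! hcon
  have h1 : ((t + 1 : ℕ) : ℕ∞) ≤ randComplexity 𝒢 ports P n := by
    refine le_iInf₂ fun s hs => ?_
    have : t < s := by
      by_contra! hst
      exact hcon s hst hs
    exact_mod_cast this
  have h2 : t + 1 ≤ t := by exact_mod_cast h1.trans h
  omega

end Solvable

/-! ### Towers and the iterated logarithm -/

/-- The tower of `h` twos with `z` on top. -/
def tower (z : ℕ) : ℕ → ℕ
  | 0 => z
  | h + 1 => 2 ^ tower z h

theorem tower_add (z a b : ℕ) : tower z (a + b) = tower (tower z b) a := by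
  induction a with
  | zero => simp [tower]
  | succ a ih => rw [Nat.succ_add, tower, tower, ih]

theorem tower_mono (z : ℕ) : Monotone (tower z) :=
  monotone_nat_of_le_succ fun _ => Nat.lt_two_pow_self.le

theorem tower_mono_left {z z' : ℕ} (h : z ≤ z') (a : ℕ) : tower z a ≤ tower z' a := by
  induction a with
  | zero => exact h
  | succ a ih => exact Nat.pow_le_pow_right two_pos ih

theorem le_tower (z a : ℕ) : z ≤ tower z a := tower_mono z (Nat.zero_le a)

theorem le_tower_one (z : ℕ) : z ≤ tower 1 z := by
  induction z with
  | zero => exact Nat.zero_le _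
  | succ z ih => exact Nat.lt_of_le_of_lt ih Nat.lt_two_pow_self

theorem mul_self_le_two_pow {w : ℕ} (hw : 4 ≤ w) : w * w ≤ 2 ^ w := by
  induction w, hw using Nat.le_induction with
  | base => norm_num
  | succ w hw ih => rw [pow_succ]; nlinarith

section TowerArithmetic

variable {z a x y : ℕ}

theorem mul_le_tower (hz : 4 ≤ z) (hx : x ≤ tower z a) (hy : y ≤ tower z a) :
    x * y ≤ tower z (a + 1) :=
  (Nat.mul_le_mul hx hy).trans (mul_self_le_two_pow (hz.trans (le_tower z a)))

theorem pow_le_tower (hz : 4 ≤ z) (hx : x ≤ tower z a) (hy : y ≤ tower z a) :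
    x ^ y ≤ tower z (a + 2) := by
  have h4 : 4 ≤ tower z a := hz.trans (le_tower z a)
  calc x ^ y ≤ tower z a ^ y := Nat.pow_le_pow_left hx y
    _ ≤ tower z a ^ tower z a := Nat.pow_le_pow_right (by omega) hy
    _ ≤ (2 ^ tower z a) ^ tower z a := Nat.pow_le_pow_left Nat.lt_two_pow_self.le _
    _ = 2 ^ (tower z a * tower z a) := (pow_mul _ _ _).symm
    _ ≤ 2 ^ tower z (a + 1) := Nat.pow_le_pow_right two_pos (mul_self_le_two_pow h4)

theorem add_le_tower (hz : 4 ≤ z) (hx : x ≤ tower z a) (hy : y ≤ 2) :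
    x + y ≤ tower z (a + 1) := by
  have h4 : 4 ≤ tower z a := hz.trans (le_tower z a)
  have := mul_self_le_two_pow h4
  change x + y ≤ 2 ^ tower z a
  nlinarith

end TowerArithmetic

theorem ramseyBound_le_tower {w c m : ℕ} (hw : 4 ≤ w) (hc : c ≤ w) (hm : m ≤ w) (p : ℕ) :
    ramseyBound c m p ≤ tower w (7 * p) := by
  induction p with
  | zero => exact hm
  | succ p ih =>
    have h1 := add_le_tower hw ih (y := 1) (by omega)
    have h2 : 2 ^ (ramseyBound c m p + 1) ≤ tower w (7 * p + 2) := Nat.pow_le_pow_right two_pos h1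
    have h3 := pow_le_tower hw (hc.trans (le_tower w (7 * p + 2))) h2
    have h4 := add_le_tower hw h3 (y := 1) (by omega)
    have h5 := add_le_tower hw ih (y := 2) le_rfl
    exact pow_le_tower hw h4
      (h5.trans (tower_mono w (show 7 * p + 1 ≤ 7 * p + 2 + 2 + 1 by omega)))

theorem card_localView_le {Δ p z : ℕ} {Inp : Type} [Finite Inp] (hz : 4 ≤ z) (hp : p ≤ z)
    (hΔ : Δ + 1 ≤ z) (hI : Nat.card Inp ≤ z) :
    Nat.card (LocalView Δ Inp (Fin p)) ≤ tower z 6 := by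
  have h1 : Nat.card (LocalView Δ Inp (Fin p)) ≤ Nat.card (((Fin p → Fin (Δ + 1)) ×
      (Fin p → Inp)) × ((Fin p → Fin Δ → Fin p) × (Fin p → Fin Δ → Fin Δ))) :=
    Nat.card_le_card_of_injective (fun N => ((N.deg, N.inp), (N.nbr, N.port))) fun N N' h => by
      simp only [Prod.mk.injEq] at h
      exact LocalView.ext h.1.1 h.1.2 h.2.1 h.2.2
  refine h1.trans ?_
  rw [Nat.card_prod, Nat.card_prod, Nat.card_prod]
  simp only [Nat.card_fun, Nat.card_fin]
  have hpow : ∀ x y, x ≤ z → y ≤ z → x ^ y ≤ tower z 2 := fun x y hx hy =>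
    pow_le_tower (a := 0) hz hx hy
  have hpow' : ∀ x, x ≤ tower z 2 → x ^ p ≤ tower z 4 := fun x hx =>
    pow_le_tower hz hx (hp.trans (le_tower z 2))
  have hlift : ∀ x, x ≤ tower z 2 → x ≤ tower z 4 := fun x hx => hx.trans (tower_mono z (by omega))
  refine mul_le_tower hz (mul_le_tower hz (hlift _ (hpow _ _ hΔ hp)) (hlift _ (hpow _ _ hI hp)))
    (mul_le_tower hz (hpow' _ (hpow _ _ hp (by omega))) (hpow' _ (hpow _ _ (by omega) (by omega))))

theorem tower_lt_of_lt_logStar {h n : ℕ} (hn : h < logStar n) : tower 1 h < n := by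
  have hgt : ∀ i ≤ h, 1 < (Real.logb 2)^[i] (n : ℝ) := fun i hi =>
    not_le.1 fun hcon => Nat.notMem_of_lt_sInf (lt_of_le_of_lt hi hn) hcon
  have key : ∀ j ≤ h, (tower 1 j : ℝ) < (Real.logb 2)^[h - j] (n : ℝ) := by
    intro j
    induction j with
    | zero => exact fun _ => by simpa [tower] using hgt h le_rfl
    | succ j ih =>
      intro hj
      have h1 := ih (by omega)
      rw [show h - j = (h - (j + 1)) + 1 by omega, Function.iterate_succ_apply'] at h1
      have h2 : 0 < (Real.logb 2)^[h - (j + 1)] (n : ℝ) :=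
        lt_trans one_pos (hgt _ (by omega))
      rw [Real.lt_logb_iff_rpow_lt one_lt_two h2, Real.rpow_natCast] at h1
      rw [tower]
      exact_mod_cast h1
  have := key h le_rfl
  rw [Nat.sub_self, Function.iterate_zero, id_eq] at this
  exact_mod_cast this

theorem exists_iterate_logb_le_one (x : ℝ) : ∃ i, (Real.logb 2)^[i] x ≤ 1 := by
  by_contra! hcon
  -- As long as the iterates exceed 1, they decrease by at least 1 in every step.
  have hstep : ∀ i, (Real.logb 2)^[i + 1] x ≤ (Real.logb 2)^[i] x - 1 := by
    intro i
    have h1 := hcon (i + 1)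
    have h0 := hcon i
    rw [Function.iterate_succ_apply'] at h1 ⊢
    generalize (Real.logb 2)^[i] x = y at h0 h1
    have hy : 2 < y := by
      rw [Real.lt_logb_iff_rpow_lt one_lt_two (by linarith)] at h1
      simpa using h1
    rw [Real.logb_le_iff_le_rpow one_lt_two (by linarith)]
    have := one_add_mul_self_le_rpow_one_add (s := 1) (by norm_num) (p := y - 1) (by linarith)
    norm_num at this
    linarith
  have hlin : ∀ i : ℕ, (Real.logb 2)^[i] x ≤ x - i := by
    intro i
    induction i with
    | zero => simp
    | succ i ih =>
      push_cast
      linarith [hstep i]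
  obtain ⟨i, hi⟩ := exists_nat_ge x
  linarith [hlin i, hcon i]

theorem tendsto_logStar : Tendsto logStar atTop atTop := by
  refine tendsto_atTop.2 fun h => eventually_atTop.2 ⟨tower 1 h, fun n hn => ?_⟩
  have key : ∀ i ≤ h, (tower 1 (h - i) : ℝ) ≤ (Real.logb 2)^[i] (n : ℝ) := by
    intro i
    induction i with
    | zero => exact fun _ => by simpa using hn
    | succ i ih =>
      intro hi
      have h1 := ih (by omega)
      rw [show h - i = (h - (i + 1)) + 1 by omega, tower] at h1
      push_cast at h1
      rw [Function.iterate_succ_apply', Real.le_logb_iff_rpow_le one_lt_two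
        (lt_of_lt_of_le (by positivity) h1), Real.rpow_natCast]
      exact h1
  have hmem : (Real.logb 2)^[logStar n] (n : ℝ) ≤ 1 :=
    Nat.sInf_mem (s := {i : ℕ | (Real.logb 2)^[i] (n : ℝ) ≤ 1})
      (exists_iterate_logb_le_one (n : ℝ))
  by_contra! hlt
  have h1 := key _ hlt.le
  rw [show h - logStar n = (h - logStar n - 1) + 1 by omega, tower] at h1
  have h2 : (2 : ℝ) ≤ ((2 ^ tower 1 (h - logStar n - 1) : ℕ) : ℝ) := by
    have : 1 ≤ tower 1 (h - logStar n - 1) := le_tower 1 _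
    exact_mod_cast Nat.le_self_pow (by omega) 2
  linarith

/-- The quantities in the Ramsey argument and in the choice of random bits are towers whose
height is linear in the number `p` of vertices of the local views. -/
theorem exists_forall_ramseyBound_le (Δ : ℕ) (Inp Out : Type) [Finite Inp] [Finite Out] :
    ∃ K : ℕ, ∀ p n : ℕ, K * p + K ≤ logStar n →
      p ≤ n ∧ ramseyBound (Nat.card (LocalView Δ Inp (Fin p) × Fin p → Out)) (2 * p) p ≤ n ∧
      Nat.card (LocalView Δ Inp (Fin p) × Fin p × (Fin p → Fin (ramseyBound
        (Nat.card (LocalView Δ Inp (Fin p) × Fin p → Out)) (2 * p) p))) < n := by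
  set s := Δ + Nat.card Inp + Nat.card Out + 4 with hs
  refine ⟨s + 14, fun p n hn => ?_⟩
  set z := p + s with hz
  have hz4 : 4 ≤ z := by omega
  have hview : Nat.card (LocalView Δ Inp (Fin p)) ≤ tower z 6 :=
    card_localView_le hz4 (by omega) (by omega) (by omega)
  set c := Nat.card (LocalView Δ Inp (Fin p) × Fin p → Out) with hc
  have hp : ∀ a, p ≤ tower z a := fun a => le_trans (by omega) (le_tower z a)
  have hc9 : c ≤ tower z 9 := by
    rw [hc, Nat.card_fun, Nat.card_prod, Nat.card_fin]
    exact pow_le_tower hz4 (le_trans (by omega) (le_tower z 7)) (mul_le_tower hz4 hview (hp 6))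
  have h2p : 2 * p ≤ tower z 9 :=
    (mul_le_tower (a := 0) hz4 (by change 2 ≤ z; omega) (hp 0)).trans (tower_mono z (by omega))
  set M := ramseyBound c (2 * p) p with hM
  have hMt : M ≤ tower z (7 * p + 9) := by
    rw [tower_add]
    exact ramseyBound_le_tower (hz4.trans (le_tower z 9)) hc9 h2p p
  have hcount : Nat.card (LocalView Δ Inp (Fin p) × Fin p × (Fin p → Fin M)) ≤
      tower z (7 * p + 13) := by
    rw [Nat.card_prod, Nat.card_prod, Nat.card_fun, Nat.card_fin, Nat.card_fin]
    exact mul_le_tower hz4 (hview.trans (tower_mono z (by omega)))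
      (mul_le_tower hz4 (hp _) (pow_le_tower hz4 hMt (hp _)))
  have hlt : tower z (7 * p + 13) < n := by
    refine lt_of_le_of_lt (tower_mono_left (le_tower_one z) _) ?_
    rw [← tower_add]
    refine tower_lt_of_lt_logStar (lt_of_lt_of_le ?_ hn)
    nlinarith
  exact ⟨(hp _).trans hlt.le, (hMt.trans (tower_mono z (by omega))).trans hlt.le,
    lt_of_le_of_lt hcount hlt⟩

/-! ### The gap -/

/-- Below a function `f` that is small compared with `log*` even after the growth function `b` of
the class has been applied, complexities are bounded. The sizes `m` whose graphs represent all sufficiently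
large ones need only be infinitely many, as tori exist for square numbers only. -/
theorem gapBelow_of_embeds {Inp Out : Type} [Finite Inp] [Finite Out] (P : LCL Inp Out)
    (ports : Bool) {𝒢 : GraphClass} {Δ : ℕ} {b : ℕ → ℕ} {f : ℕ → ℝ} (hmono : Monotone b)
    (hΔ : ∀ n G, 𝒢 n G → boundedDegree Δ n G)
    (hball : ∀ n G, 𝒢 n G → ∀ v R, (nbhd G v R).ncard ≤ b R)
    (hemb : ∃ᶠ m in atTop, ∀ R, b (R + 2) ≤ m → ∀ᶠ n in atTop, Embeds 𝒢 R n m)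
    (hgrow : ∀ K a : ℕ, ∃ ε : ℝ, 0 < ε ∧ ∀ᶠ n in atTop, ∀ t : ℕ, (t : ℝ) ≤ ε * f n →
      K * b (t + a) + K ≤ logStar n) :
    GapBelow 𝒢 ports P f := by
  obtain ⟨K, hK⟩ := exists_forall_ramseyBound_le Δ Inp Out
  obtain ⟨ε, hε, hεn⟩ := hgrow K (P.radius + 3)
  have hdeg : ∀ n G, 𝒢 n G → ∀ (π : PortNumbering G) u, π.deg u ≤ Δ :=
    fun n G hG π u => (π.deg_eq_ncard u).trans_le (hΔ n G hG u)
  have hb : ∀ n G, 𝒢 n G → ∀ (T : ℕ) v,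
      (nbhd G v (P.radius + T + 1)).ncard ≤ b (T + (P.radius + 3)) :=
    fun n G hG T v => (hball n G hG v _).trans (hmono (by omega))
  -- In both models, the number `T` of rounds for a single suitable `m` is the bound sought.
  refine ⟨fun k hk hlo => ?_, fun hlo => ?_⟩
  · obtain ⟨m, hm, ⟨t, hct, htε⟩, hgr⟩ := (hemb.and_eventually ((hlo ε hε).and hεn)).exists
    obtain ⟨T, hTt, A, hA, hsol⟩ := exists_solvable_of_detComplexity_le hct
    obtain ⟨h1, h2, -⟩ := hK _ _ (hgr T (le_trans (by exact_mod_cast hTt) htε))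
    obtain ⟨B, hB, hval⟩ := exists_valid_of_locallySolves ports P A
      (R := P.radius + T + 1) (T := T) (Nat.le_succ _) h2
    refine ⟨T, ?_⟩
    filter_upwards [hm (P.radius + T + 1) ((hmono
      (show P.radius + T + 1 + 2 ≤ T + (P.radius + 3) by omega)).trans h1)] with n hn
    refine iInf₂_le T ⟨B, fun hp => hB (hA hp), fun G hG π inp x hx _ => ?_⟩
    exact hval 𝒢 n (locallySolves_of_det hk hsol le_rfl hn (hΔ n)) G hG (hb n G hG T) π inp x
      (hdeg n G hG π) hx
  · obtain ⟨m, hm, ⟨t, hct, htε⟩, hgr⟩ := (hemb.and_eventually ((hlo ε hε).and hεn)).exists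
    obtain ⟨T, hTt, A, hA, hsol⟩ := exists_solvable_of_randComplexity_le hct
    obtain ⟨h1, -, h3⟩ := hK _ _ (hgr T (le_trans (by exact_mod_cast hTt) htε))
    obtain ⟨ρ, hρ⟩ := exists_locallySolves_of_rand
      (fun G hG π inp => (hsol G hG π inp).2) le_rfl h3
    obtain ⟨B, hB, hval⟩ := exists_valid_of_locallySolves ports P (A.comap ρ)
      (R := P.radius + T + 1) (T := T) (Nat.le_succ _) le_rfl
    refine ⟨T, ?_⟩
    filter_upwards [hm (P.radius + T + 1) ((hmono
      (show P.radius + T + 1 + 2 ≤ T + (P.radius + 3) by omega)).trans h1)] with n hn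
    refine iInf₂_le T (randSolvable_of_forall_valid (fun hp => hB (hA hp))
      fun G hG π inp x hx => ?_)
    exact hval 𝒢 n (hρ n hn (hΔ n) fun G hG v => hb n G hG T v) G hG (hb n G hG T) π inp x
      (hdeg n G hG π) hx

/-! ### Graphs and trees of bounded degree -/

section BoundedDegree

theorem ncard_nbhd_le_of_boundedDegree {Δ n : ℕ} {G : SimpleGraph (Fin n)}
    (hG : boundedDegree Δ n G) (v : Fin n) (R : ℕ) : (nbhd G v R).ncard ≤ (Δ + 1) ^ R := by
  classical
  induction R with
  | zero =>
    have : nbhd G v 0 = {v} := by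
      ext u
      exact mem_nbhd_zero
    simp [this]
  | succ R ih =>
    let s := (nbhd G v R).toFinite.toFinset
    let t : Fin n → Finset (Fin n) := fun w => insert w (G.neighborSet w).toFinite.toFinset
    have hsub : nbhd G v (R + 1) ⊆ (s.biUnion t : Finset (Fin n)) := by
      intro u hu
      rw [Finset.mem_coe, Finset.mem_biUnion]
      rcases mem_nbhd_succ.1 hu with hu | ⟨w, hw, hwu⟩
      · exact ⟨u, by simpa [s] using hu, by simp [t]⟩
      · exact ⟨w, by simpa [s] using hw, by simp [t, hwu]⟩
    have ht : ∀ w ∈ s, (t w).card ≤ Δ + 1 := by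
      intro w _
      refine (Finset.card_insert_le _ _).trans (Nat.succ_le_succ ?_)
      rw [← Set.ncard_eq_toFinset_card]
      exact hG w
    calc (nbhd G v (R + 1)).ncard ≤ (s.biUnion t).card := by
          rw [← Set.ncard_coe_finset]
          exact Set.ncard_le_ncard hsub
      _ ≤ s.card * (Δ + 1) := Finset.card_biUnion_le_card_mul _ _ _ ht
      _ ≤ (Δ + 1) ^ R * (Δ + 1) := by
          refine Nat.mul_le_mul_right _ ?_
          rw [← Set.ncard_eq_toFinset_card]
          exact ih
      _ = (Δ + 1) ^ (R + 1) := (pow_succ _ _).symm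

theorem nbhd_induce_connected {V : Type} (G : SimpleGraph V) (v : V) (R : ℕ) :
    (G.induce (nbhd G v R)).Connected := by
  classical
  refine G.induce_connected_of_patches v (mem_nbhd_self G v R) ?_
  intro w hw
  obtain ⟨p, hp⟩ := mem_nbhd_iff_exists_walk.1 hw
  refine ⟨{u | u ∈ p.support}, fun u hu => ?_, p.start_mem_support, p.end_mem_support,
    p.connected_induce_support _ _⟩
  exact mem_nbhd_iff_exists_walk.2 ⟨p.takeUntil u hu, (p.length_takeUntil_le_length hu).trans hp⟩

/-- In a finite connected graph, every connected vertex set extends to connected vertex sets of all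
larger sizes. -/
theorem exists_connected_superset {n : ℕ} {G : SimpleGraph (Fin n)} (hG : G.Connected)
    (D : Set (Fin n)) (hD : (G.induce D).Connected) {m : ℕ} (hm : m ≤ n) :
    D.ncard ≤ m → ∃ D', D ⊆ D' ∧ (G.induce D').Connected ∧ D'.ncard = m := by
  intro h
  obtain ⟨j, hj⟩ := Nat.exists_eq_add_of_le h
  induction j generalizing D with
  | zero => exact ⟨D, subset_rfl, hD, by omega⟩
  | succ j ih =>
    have hne : ∃ b, b ∉ D := by
      by_contra! hcon
      rw [Set.eq_univ_of_forall hcon, Set.ncard_univ, Nat.card_fin] at hj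
      omega
    obtain ⟨b, hb⟩ := hne
    obtain ⟨⟨a, ha⟩⟩ := hD.nonempty
    obtain ⟨p⟩ := hG.preconnected a b
    obtain ⟨d, -, hd1, hd2⟩ := p.exists_boundary_dart D ha hb
    have hconn : (G.induce (D ∪ {d.snd})).Connected := by
      refine SimpleGraph.connected_induce_union hD.preconnected ?_ hd1 (Set.mem_singleton _) d.adj
      exact (SimpleGraph.Preconnected.of_subsingleton)
    have hcard : (D ∪ {d.snd}).ncard = D.ncard + 1 := by
      rw [Set.union_singleton, Set.ncard_insert_of_notMem hd2]
    obtain ⟨D', h1, h2, h3⟩ := ih (D ∪ {d.snd}) hconn (by omega) (by omega)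
    exact ⟨D', Set.subset_union_left.trans h1, h2, h3⟩

/-- The subgraph induced by `m` vertices that contain the neighbourhood of `v`, on the vertex set
`Fin m`. -/
theorem exists_embedding_of_induce {n m R : ℕ} {G : SimpleGraph (Fin n)} {v : Fin n}
    {D : Set (Fin n)} (hD : nbhd G v (R + 1) ⊆ D) (hm : D.ncard = m) :
    ∃ (G' : SimpleGraph (Fin m)) (ψ : Fin n → Fin m), Nonempty (G' ≃g G.induce D) ∧
      Set.InjOn ψ (nbhd G v (R + 1)) ∧
      ∀ u ∈ nbhd G v R, ψ '' G.neighborSet u = G'.neighborSet (ψ u) := by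
  classical
  have e : D ≃ Fin m := Finite.equivFinOfCardEq (by rw [Nat.card_coe_set_eq, hm])
  let G' := (G.induce D).comap e.symm
  let v' : D := ⟨v, hD (mem_nbhd_self G v _)⟩
  let ψ : Fin n → Fin m := fun u => if hu : u ∈ D then e ⟨u, hu⟩ else e v'
  have hψ : ∀ u (hu : u ∈ D), ψ u = e ⟨u, hu⟩ := fun u hu => dif_pos hu
  refine ⟨G', ψ, ⟨SimpleGraph.Iso.comap e.symm _⟩, ?_, ?_⟩
  · intro a ha b hb hab
    rw [hψ a (hD ha), hψ b (hD hb)] at hab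
    exact congrArg Subtype.val (e.injective hab)
  · intro u hu
    have huD : u ∈ D := hD (nbhd_mono (Nat.le_succ R) hu)
    rw [hψ u huD]
    ext i
    have hadj : G'.Adj (e ⟨u, huD⟩) i ↔ G.Adj u (e.symm i) := by
      simp [G']
    rw [SimpleGraph.mem_neighborSet, hadj]
    constructor
    · rintro ⟨w, hw, rfl⟩
      rw [hψ w (hD (mem_nbhd_of_adj hu hw))]
      simpa using hw
    · intro h
      exact ⟨e.symm i, h, by rw [hψ _ (e.symm i).2]; simp⟩

theorem boundedDegree_of_iso_induce {Δ n m : ℕ} {G : SimpleGraph (Fin n)} {D : Set (Fin n)}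
    {G' : SimpleGraph (Fin m)} (f : G' ≃g G.induce D) (hG : boundedDegree Δ n G) :
    boundedDegree Δ m G' := by
  intro a
  refine le_trans ?_ (hG (f a))
  refine Set.ncard_le_ncard_of_injOn (fun b => (f b : Fin n)) (fun b hb => ?_)
    (fun b _ c _ hbc => f.injective (Subtype.ext hbc))
  exact f.map_rel_iff.2 hb

theorem embeds_boundedDegree {Δ R n m : ℕ} (hm : (Δ + 1) ^ (R + 1) ≤ m) (hn : m ≤ n) :
    Embeds (boundedDegree Δ) R n m := by
  intro G hG v
  obtain ⟨D, hD, -, hDm⟩ := Set.exists_subsuperset_card_eq (Set.subset_univ (nbhd G v (R + 1)))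
    ((ncard_nbhd_le_of_boundedDegree hG v (R + 1)).trans hm)
    (by rwa [Set.ncard_univ, Nat.card_fin])
  obtain ⟨G', ψ, ⟨f⟩, h⟩ := exists_embedding_of_induce hD hDm
  exact ⟨G', ψ, boundedDegree_of_iso_induce f hG, h⟩

theorem embeds_boundedDegreeTree {Δ R n m : ℕ} (hm : (Δ + 1) ^ (R + 1) ≤ m) (hn : m ≤ n) :
    Embeds (boundedDegreeTree Δ) R n m := by
  intro G hG v
  obtain ⟨D, hD, hDc, hDm⟩ := exists_connected_superset hG.1.connected _
    (nbhd_induce_connected G v (R + 1)) hn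
    ((ncard_nbhd_le_of_boundedDegree hG.2 v (R + 1)).trans hm)
  obtain ⟨G', ψ, ⟨f⟩, h⟩ := exists_embedding_of_induce hD hDm
  exact ⟨G', ψ, ⟨f.isTree_iff.2 ⟨hDc, hG.1.isAcyclic.induce D⟩,
    boundedDegree_of_iso_induce f hG.2⟩, h⟩

/-- Neighbourhoods of radius `t + O(1)` have size at most a power of `log*`, with any desired
exponent, if `t` is at most a small multiple of `log (log*)`. -/
theorem exists_growth_log (Δ K a : ℕ) : ∃ ε : ℝ, 0 < ε ∧ ∀ᶠ n in atTop, ∀ t : ℕ,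
    (t : ℝ) ≤ ε * Real.log (logStar n : ℝ) → K * (Δ + 1) ^ (t + a) + K ≤ logStar n := by
  have hlog : 0 < Real.log (Δ + 2) := Real.log_pos (by linarith [Nat.cast_nonneg (α := ℝ) Δ])
  refine ⟨1 / (2 * Real.log (Δ + 2)), by positivity, ?_⟩
  filter_upwards [tendsto_logStar.eventually_ge_atTop ((K * (Δ + 1) ^ a + K) ^ 2 + 1)]
    with n hn t ht
  set L := logStar n with hL
  have hLpos : (0 : ℝ) < L := by
    have : 0 < L := by omega
    exact_mod_cast this
  have h1 : ((Δ : ℝ) + 1) ^ t ≤ √(L : ℝ) := by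
    calc ((Δ : ℝ) + 1) ^ t ≤ ((Δ : ℝ) + 2) ^ t := by gcongr; norm_num
      _ = Real.exp (Real.log (Δ + 2) * t) := by
          rw [mul_comm, Real.exp_nat_mul, Real.exp_log (by positivity)]
      _ ≤ Real.exp (Real.log L / 2) := by
          refine Real.exp_le_exp.2 ?_
          calc Real.log (Δ + 2) * t ≤
              Real.log (Δ + 2) * (1 / (2 * Real.log (Δ + 2)) * Real.log L) := by gcongr
            _ = Real.log L / 2 := by field_simp
      _ = √(L : ℝ) := by
          rw [← Real.log_sqrt hLpos.le, Real.exp_log (Real.sqrt_pos.2 hLpos)]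
  have h2 : (K * (Δ + 1) ^ a + K : ℝ) ≤ √(L : ℝ) := by
    refine Real.le_sqrt_of_sq_le ?_
    exact_mod_cast (Nat.le_succ _).trans hn
  have h3 : (1 : ℝ) ≤ √(L : ℝ) := by
    rw [Real.one_le_sqrt]
    have : 1 ≤ L := by omega
    exact_mod_cast this
  have key : (K * (Δ + 1) ^ (t + a) + K : ℝ) ≤ L := by
    calc (K * (Δ + 1) ^ (t + a) + K : ℝ) = K * (Δ + 1) ^ a * (Δ + 1) ^ t + K * 1 := by ring
      _ ≤ K * (Δ + 1) ^ a * √(L : ℝ) + K * √(L : ℝ) := by gcongr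
      _ = (K * (Δ + 1) ^ a + K) * √(L : ℝ) := by ring
      _ ≤ √(L : ℝ) * √(L : ℝ) := by gcongr
      _ = L := Real.mul_self_sqrt hLpos.le
  exact_mod_cast key

theorem gapBelow_boundedDegree {Inp Out : Type} [Finite Inp] [Finite Out] (P : LCL Inp Out)
    (ports : Bool) (Δ : ℕ) : GapBelow (boundedDegree Δ) ports P
      (fun n => Real.log (logStar n : ℝ)) := by
  have hmono : Monotone fun R : ℕ => (Δ + 1) ^ R := pow_right_mono₀ (by omega)
  refine gapBelow_of_embeds P ports hmono (fun n G hG => hG)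
    (fun n G hG => ncard_nbhd_le_of_boundedDegree hG) (Eventually.frequently ?_)
    (exists_growth_log Δ)
  refine Eventually.of_forall fun m R hm => (eventually_ge_atTop m).mono fun n hn => ?_
  exact embeds_boundedDegree ((hmono (by omega : R + 1 ≤ R + 2)).trans hm) hn

theorem gapBelow_boundedDegreeTree {Inp Out : Type} [Finite Inp] [Finite Out] (P : LCL Inp Out)
    (ports : Bool) (Δ : ℕ) : GapBelow (boundedDegreeTree Δ) ports P
      (fun n => Real.log (logStar n : ℝ)) := by
  have hmono : Monotone fun R : ℕ => (Δ + 1) ^ R := pow_right_mono₀ (by omega)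
  refine gapBelow_of_embeds P ports hmono (fun n G hG => hG.2)
    (fun n G hG => ncard_nbhd_le_of_boundedDegree hG.2) (Eventually.frequently ?_)
    (exists_growth_log Δ)
  refine Eventually.of_forall fun m R hm => (eventually_ge_atTop m).mono fun n hn => ?_
  exact embeds_boundedDegreeTree ((hmono (by omega : R + 1 ≤ R + 2)).trans hm) hn

end BoundedDegree

/-! ### Rings and tori -/

/-- `q` is a covering map from `H` to `G` that is injective on neighbourhoods of radius less than
`s / 2`. -/
structure IsCovering {Λ V : Type} (H : SimpleGraph Λ) (G : SimpleGraph V) (q : Λ → V) (s : ℕ) :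
    Prop where
  surj : Function.Surjective q
  nbr : ∀ a, q '' H.neighborSet a = G.neighborSet (q a)
  inj : ∀ a R, 2 * R < s → Set.InjOn q (nbhd H a R)

section Covering

variable {Λ Λ' V V' : Type} {H : SimpleGraph Λ} {G : SimpleGraph V} {q : Λ → V} {s : ℕ}
  {H' : SimpleGraph Λ'} {G' : SimpleGraph V'} {q' : Λ' → V'}

theorem IsCovering.nbhd_eq (h : IsCovering H G q s) (a : Λ) (R : ℕ) :
    nbhd G (q a) R = q '' nbhd H a R := by
  induction R with
  | zero =>
    ext u
    simp only [mem_nbhd_zero, Set.mem_image]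
    exact ⟨fun hu => ⟨a, rfl, hu.symm⟩, by rintro ⟨_, rfl, rfl⟩; rfl⟩
  | succ R ih =>
    ext u
    rw [mem_nbhd_succ, ih]
    constructor
    · rintro (⟨b, hb, rfl⟩ | ⟨_, ⟨b, hb, rfl⟩, hadj⟩)
      · exact ⟨b, nbhd_mono (Nat.le_succ R) hb, rfl⟩
      · have hu : u ∈ G.neighborSet (q b) := hadj
        rw [← h.nbr] at hu
        obtain ⟨c, hc, rfl⟩ := hu
        exact ⟨c, mem_nbhd_of_adj hb hc, rfl⟩
    · rintro ⟨c, hc, rfl⟩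
      rcases mem_nbhd_succ.1 hc with hc | ⟨b, hb, hbc⟩
      · exact .inl ⟨c, hc, rfl⟩
      · refine .inr ⟨q b, ⟨b, hb, rfl⟩, ?_⟩
        have : q c ∈ G.neighborSet (q b) := h.nbr b ▸ Set.mem_image_of_mem q hbc
        exact this

theorem IsCovering.comp_iso (h : IsCovering H G q s) (f : G ≃g G') :
    IsCovering H G' (f ∘ q) s where
  surj := f.surjective.comp h.surj
  nbr a := by
    rw [Set.image_comp, h.nbr]
    ext w
    constructor
    · rintro ⟨u, hu, rfl⟩
      exact f.map_rel_iff.2 hu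
    · intro hw
      refine ⟨f.symm w, ?_, f.apply_symm_apply w⟩
      have : G.Adj (f.symm (f (q a))) (f.symm w) := f.symm.map_rel_iff.2 hw
      simpa using this
  inj a R hR := f.injective.comp_injOn (h.inj a R hR)

theorem IsCovering.boxProd (h : IsCovering H G q s) (h' : IsCovering H' G' q' s) :
    IsCovering (H.boxProd H') (G.boxProd G') (Prod.map q q') s where
  surj := h.surj.prodMap h'.surj
  nbr a := by
    obtain ⟨a, a'⟩ := a
    rw [SimpleGraph.neighborSet_boxProd, SimpleGraph.neighborSet_boxProd, Set.image_union,
      Set.prodMap_image_prod, Set.prodMap_image_prod, h.nbr, h'.nbr]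
    simp
  inj a R hR := by
    rintro ⟨b, b'⟩ hb ⟨c, c'⟩ hc hbc
    have hsub : ∀ x : Λ × Λ', x ∈ nbhd (H.boxProd H') a R →
        x.1 ∈ nbhd H a.1 R ∧ x.2 ∈ nbhd H' a.2 R := by
      intro x hx
      have hx' : (H.boxProd H').edist a x ≤ R := hx
      rw [SimpleGraph.edist_boxProd] at hx'
      exact ⟨le_self_add.trans hx', le_add_self.trans hx'⟩
    rw [Prod.map_apply, Prod.map_apply, Prod.mk.injEq] at hbc
    exact Prod.ext (h.inj a.1 R hR (hsub _ hb).1 (hsub _ hc).1 hbc.1)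
      (h'.inj a.2 R hR (hsub _ hb).2 (hsub _ hc).2 hbc.2)

/-- Two graphs covered by the same graph look alike locally. -/
theorem IsCovering.exists_embedding {s' : ℕ} (h : IsCovering H G q s) {q' : Λ → V'}
    (h' : IsCovering H G' q' s') {R : ℕ} (hs : 2 * (R + 1) < s) (hs' : 2 * (R + 1) < s') (v : V) :
    ∃ ψ : V → V', Set.InjOn ψ (nbhd G v (R + 1)) ∧
      ∀ u ∈ nbhd G v R, ψ '' G.neighborSet u = G'.neighborSet (ψ u) := by
  obtain ⟨a, rfl⟩ := h.surj v
  have : Nonempty Λ := ⟨a⟩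
  let g : V → Λ := Function.invFunOn q (nbhd H a (R + 1))
  have hg : ∀ b ∈ nbhd H a (R + 1), g (q b) = b := fun b hb =>
    (h.inj a _ hs).leftInvOn_invFunOn hb
  refine ⟨q' ∘ g, ?_, ?_⟩
  · rw [h.nbhd_eq]
    rintro _ ⟨b, hb, rfl⟩ _ ⟨c, hc, rfl⟩ hbc
    simp only [Function.comp_apply, hg b hb, hg c hc] at hbc
    rw [h'.inj a _ hs' hb hc hbc]
  · rw [h.nbhd_eq]
    rintro _ ⟨b, hb, rfl⟩
    rw [Function.comp_apply, hg b (nbhd_mono (Nat.le_succ R) hb), ← h.nbr, ← h'.nbr,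
      Set.image_image]
    exact Set.image_congr fun c hc => by rw [Function.comp_apply, hg c (mem_nbhd_of_adj hb hc)]

/-- The gap for a class of finite quotients of an infinite graph `H`. -/
theorem gapBelow_of_isCovering {Inp Out : Type} [Finite Inp] [Finite Out] (P : LCL Inp Out)
    (ports : Bool) {𝒢 : GraphClass} {b : ℕ → ℕ} {f : ℕ → ℝ} (hmono : Monotone b)
    (hb : ∀ a R, (nbhd H a R).Finite ∧ (nbhd H a R).ncard ≤ b R)
    (hcov : ∀ n G, 𝒢 n G → ∃ q s, IsCovering H G q s ∧ ∀ R, b (R + 2) ≤ n → 2 * (R + 1) < s)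
    (hne : ∃ᶠ n in atTop, ∃ G, 𝒢 n G)
    (hgrow : ∀ K a : ℕ, ∃ ε : ℝ, 0 < ε ∧ ∀ᶠ n in atTop, ∀ t : ℕ, (t : ℝ) ≤ ε * f n →
      K * b (t + a) + K ≤ logStar n) :
    GapBelow 𝒢 ports P f := by
  have hball : ∀ n G, 𝒢 n G → ∀ v R, (nbhd G v R).ncard ≤ b R := by
    intro n G hG v R
    obtain ⟨q, s, h, -⟩ := hcov n G hG
    obtain ⟨a, rfl⟩ := h.surj v
    rw [h.nbhd_eq]
    exact (Set.ncard_image_le (hb a R).1).trans (hb a R).2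
  refine gapBelow_of_embeds P ports (Δ := b 1) hmono (fun n G hG v => ?_) hball ?_ hgrow
  · refine (Set.ncard_le_ncard ?_).trans (hball n G hG v 1)
    intro w hw
    exact mem_nbhd_of_adj (mem_nbhd_self G v 0) hw
  · refine hne.mono ?_
    rintro m ⟨G', hG'⟩ R hR
    filter_upwards [eventually_ge_atTop m] with n hn G hG v
    obtain ⟨q, s, h, hs⟩ := hcov n G hG
    obtain ⟨q', s', h', hs'⟩ := hcov m G' hG'
    obtain ⟨ψ, hψ⟩ := h.exists_embedding h' (hs R (hR.trans hn)) (hs' R hR) v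
    exact ⟨G', ψ, hG', hψ⟩

/-- The two-way infinite path. -/
def line : SimpleGraph ℤ := SimpleGraph.circulantGraph {1}

theorem neighborSet_line (a : ℤ) : line.neighborSet a = {a - 1, a + 1} := by
  ext b
  simp only [SimpleGraph.mem_neighborSet, line, SimpleGraph.circulantGraph_adj,
    Set.mem_singleton_iff, Set.mem_insert_iff]
  omega

theorem nbhd_line_subset (a : ℤ) (R : ℕ) : nbhd line a R ⊆ Finset.Icc (a - R) (a + R) := by
  induction R with
  | zero =>
    intro b hb
    rw [mem_nbhd_zero.1 hb]
    simp
  | succ R ih =>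
    intro b hb
    rcases mem_nbhd_succ.1 hb with hb | ⟨c, hc, hcb⟩
    · have := ih hb
      simp only [Finset.coe_Icc, Set.mem_Icc] at this ⊢
      push_cast
      omega
    · have := ih hc
      have hcb' : b ∈ line.neighborSet c := hcb
      rw [neighborSet_line, Set.mem_insert_iff, Set.mem_singleton_iff] at hcb'
      simp only [Finset.coe_Icc, Set.mem_Icc] at this ⊢
      push_cast
      omega

theorem ncard_nbhd_line (a : ℤ) (R : ℕ) :
    (nbhd line a R).Finite ∧ (nbhd line a R).ncard ≤ 2 * R + 1 := by
  refine ⟨(Finset.finite_toSet _).subset (nbhd_line_subset a R), ?_⟩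
  refine (Set.ncard_le_ncard (nbhd_line_subset a R) (Finset.finite_toSet _)).trans ?_
  rw [Set.ncard_coe_finset, Int.card_Icc]
  omega

theorem ncard_nbhd_grid (a : ℤ × ℤ) (R : ℕ) :
    (nbhd (line.boxProd line) a R).Finite ∧
      (nbhd (line.boxProd line) a R).ncard ≤ (2 * R + 1) ^ 2 := by
  have hsub : nbhd (line.boxProd line) a R ⊆ nbhd line a.1 R ×ˢ nbhd line a.2 R := by
    intro x hx
    have hx' : (line.boxProd line).edist a x ≤ R := hx
    rw [SimpleGraph.edist_boxProd] at hx'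
    exact ⟨le_self_add.trans hx', le_add_self.trans hx'⟩
  have hfin := (ncard_nbhd_line a.1 R).1.prod (ncard_nbhd_line a.2 R).1
  refine ⟨hfin.subset hsub, (Set.ncard_le_ncard hsub hfin).trans ?_⟩
  rw [Set.ncard_prod, sq]
  exact Nat.mul_le_mul (ncard_nbhd_line a.1 R).2 (ncard_nbhd_line a.2 R).2

theorem exists_isCovering_cycleGraph {n : ℕ} (hn : 3 ≤ n) :
    ∃ q, IsCovering line (SimpleGraph.cycleGraph n) q n := by
  obtain ⟨k, rfl⟩ := Nat.exists_eq_add_of_le' hn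
  let q : ℤ → Fin (k + 3) := fun i => ((i : ZMod (k + 3)) : Fin (k + 3))
  refine ⟨q, ?_, ?_, ?_⟩
  · exact ZMod.intCast_surjective (n := k + 3)
  · intro a
    rw [neighborSet_line, Set.image_pair, SimpleGraph.cycleGraph_neighborSet]
    have h1 : q (a - 1) = q a - 1 := by
      change ((a - 1 : ℤ) : ZMod (k + 3)) = (a : ZMod (k + 3)) - 1
      push_cast
      rfl
    have h2 : q (a + 1) = q a + 1 := by
      change ((a + 1 : ℤ) : ZMod (k + 3)) = (a : ZMod (k + 3)) + 1
      push_cast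
      rfl
    rw [h1, h2]
  · intro a R hR b hb c hc hbc
    have hb' := nbhd_line_subset a R hb
    have hc' := nbhd_line_subset a R hc
    simp only [Finset.coe_Icc, Set.mem_Icc] at hb' hc'
    have hdvd : ((k + 3 : ℕ) : ℤ) ∣ c - b :=
      (ZMod.intCast_eq_intCast_iff_dvd_sub b c (k + 3)).1 hbc
    have h0 := Int.eq_zero_of_abs_lt_dvd hdvd (by rw [abs_lt]; omega)
    omega

end Covering

theorem gapBelow_ring {Inp Out : Type} [Finite Inp] [Finite Out] (P : LCL Inp Out)
    (ports : Bool) : GapBelow ring ports P (fun n => (logStar n : ℝ)) := by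
  refine gapBelow_of_isCovering P ports (H := line) (b := fun R => 2 * R + 1)
    (fun R R' h => by dsimp only; omega) ncard_nbhd_line ?_ ?_ ?_
  · rintro n G ⟨hn, ⟨f⟩⟩
    obtain ⟨q, hq⟩ := exists_isCovering_cycleGraph hn
    exact ⟨_, n, hq.comp_iso f.symm, fun R hR => by omega⟩
  · refine Eventually.frequently ?_
    filter_upwards [eventually_ge_atTop 3] with n hn
    exact ⟨_, hn, ⟨SimpleGraph.Iso.refl⟩⟩
  · intro K a
    refine ⟨1 / (4 * (K + 1)), by positivity, ?_⟩
    filter_upwards [tendsto_logStar.eventually_ge_atTop (2 * (K * (2 * a + 1) + K))]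
      with n hn t ht
    have h1 : (2 * (K * (2 * a + 1) + K) : ℝ) ≤ logStar n := by exact_mod_cast hn
    have h2 : (2 * K * t : ℝ) ≤ logStar n / 2 := by
      calc (2 * K * t : ℝ) ≤ 2 * (K + 1) * t := by gcongr; linarith
        _ ≤ 2 * (K + 1) * (1 / (4 * (K + 1)) * logStar n) := by gcongr
        _ = logStar n / 2 := by field_simp; ring
    have key : (K * (2 * (t + a) + 1) + K : ℝ) ≤ logStar n := by nlinarith
    exact_mod_cast key

theorem gapBelow_torus {Inp Out : Type} [Finite Inp] [Finite Out] (P : LCL Inp Out)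
    (ports : Bool) : GapBelow torus ports P (fun n => √(logStar n : ℝ)) := by
  refine gapBelow_of_isCovering P ports (H := line.boxProd line) (b := fun R => (2 * R + 1) ^ 2)
    (fun R R' h => Nat.pow_le_pow_left (by omega) 2) ncard_nbhd_grid ?_ ?_ ?_
  · rintro n G ⟨s, hs, rfl, ⟨f⟩⟩
    obtain ⟨q, hq⟩ := exists_isCovering_cycleGraph hs
    refine ⟨_, s, (hq.boxProd hq).comp_iso f.symm, fun R hR => ?_⟩
    have h1 : 2 * (R + 2) + 1 ≤ s := by
      rw [← sq] at hR
      exact (Nat.pow_le_pow_iff_left two_ne_zero).1 hR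
    omega
  · refine frequently_atTop.2 fun N => ⟨(N + 3) * (N + 3), by nlinarith, ?_⟩
    exact ⟨((SimpleGraph.cycleGraph (N + 3)).boxProd (SimpleGraph.cycleGraph (N + 3))).comap
      finProdFinEquiv.symm, N + 3, by omega, rfl, ⟨SimpleGraph.Iso.comap _ _⟩⟩
  · intro K a
    refine ⟨1 / (4 * (K + 1)), by positivity, ?_⟩
    filter_upwards [tendsto_logStar.eventually_ge_atTop (2 * (K * (2 * (2 * a + 1) ^ 2) + K))]
      with n hn t ht
    have h1 : (2 * (K * (2 * (2 * a + 1) ^ 2) + K) : ℝ) ≤ logStar n := by exact_mod_cast hn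
    have h2 := pow_le_pow_left₀ (Nat.cast_nonneg t) ht 2
    rw [mul_pow, Real.sq_sqrt (Nat.cast_nonneg _)] at h2
    have h3 : (8 * K * t ^ 2 : ℝ) ≤ logStar n / 2 := by
      calc (8 * K * t ^ 2 : ℝ) ≤ 8 * ((K + 1) * (K + 1)) * t ^ 2 := by gcongr; nlinarith
        _ ≤ 8 * ((K + 1) * (K + 1)) * ((1 / (4 * (K + 1))) ^ 2 * logStar n) := by gcongr
        _ = logStar n / 2 := by field_simp; ring
    have h4 : ((2 * (t + a) + 1) ^ 2 : ℝ) ≤ 8 * t ^ 2 + 2 * (2 * a + 1) ^ 2 := by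
      nlinarith [sq_nonneg ((2 * t : ℝ) - (2 * a + 1))]
    have key : (K * (2 * (t + a) + 1) ^ 2 + K : ℝ) ≤ logStar n := by
      have := mul_le_mul_of_nonneg_left h4 (Nat.cast_nonneg (α := ℝ) K)
      nlinarith
    exact_mod_cast key

end LocalModel

theorem mainTheorem7 {Inp Out : Type} [Finite Inp] [Finite Out]
    (P : LocalModel.LCL Inp Out) (ports : Bool) :
    LocalModel.GapBelow LocalModel.ring ports P (fun n => (LocalModel.logStar n : ℝ)) ∧
    LocalModel.GapBelow LocalModel.torus ports P (fun n => √(LocalModel.logStar n : ℝ)) ∧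
    ∀ Δ : ℕ,
      LocalModel.GapBelow (LocalModel.boundedDegreeTree Δ) ports P
        (fun n => Real.log (LocalModel.logStar n : ℝ)) ∧
      LocalModel.GapBelow (LocalModel.boundedDegree Δ) ports P
        (fun n => Real.log (LocalModel.logStar n : ℝ)) :=
  ⟨LocalModel.gapBelow_ring P ports, LocalModel.gapBelow_torus P ports, fun Δ =>
    ⟨LocalModel.gapBelow_boundedDegreeTree P ports Δ,
      LocalModel.gapBelow_boundedDegree P ports Δ⟩⟩
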